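/- Let $I \xleftarrow{s} E \xrightarrow{p} B \xrightarrow{t} I$ be a diagram of groupoids such that the homotopy fibres $E_b$ of $p$ are finite and discrete, and such that all vertex groups of $I$ and of $B$ are finite. Let $P$ be the associated polynomial endofunctor of groupoids over $I$; for $X\to I$ an object of $P(X)$ is an operation $b\in B$ with a map $E_b\to X$ over $I$. A $P$-tree is a finite rooted tree, given as a diagram of finite sets $A\leftarrow M\to N\to A$ ($A$ the edges, $N$ the nodes, $M$ the nodes with a marked input edge; $N\to A$ is injective, $M\to A$ is injective with complement the root, and from every edge one reaches the root by walking down), together with a map to $I\leftarrow E\to B\to I$ whose squares commute up to specified isomorphism and whose middle square is a homotopy pullback. Let $\mathbf T$ be the groupoid of $P$-trees, over $I$ by the colour of the root, and $\mathbf F$ the groupoid of $P$-forests, i.e. finite families of $P$-trees. Let $\mathscr B_P=\mathbb Q[T\in\pi_0\mathbf T]$ be (the algebra underlying) the bialgebra of $P$-trees. Its monomials are the isomorphism classes of forests, and its completion is $\mathbb Q[[T\in \pi_0\mathbf T]]$, in which we consider $$G=\sum_{T\in\pi_0\mathbf T}\frac{T}{|\mathrm{Aut}(T)|},\qquad \mathbf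 1=\sum_{i\in\pi_0 I}\frac{|_i}{|\mathrm{Aut}(i)|},$$ where $|_i$ is the trivial tree of colour $i$ (so $\mathbf 1$ is the series of the terminal object $I\to I$). An object of $P(\mathbf T)$ is equivalently a forest with an operation $b$ and a bijection, compatible with colours, from its roots to $E_b$. Let $P(\mathbf T)\to\mathbf F$ forget $b$ and the bijection, let $P(\mathbf T)\to\mathbf T$ graft the trees onto the corolla $b$, and let $P(\mathbf T)_b$ be the homotopy fibre of $P(\mathbf T)\to B$ over $b$. The global operator $B_+$ and the individual operators $B_+^b$ are the linear operators given by the spans $\mathbf F\leftarrow P(\mathbf T)\to\mathbf T$ and $\mathbf F\leftarrow P(\mathbf T)_b\to\mathbf T$. Here a span $\mathbf F\leftarrow M\to\mathbf T$ sends a forest $F$ to $\sum_{T\in\pi_0\mathbf T}\frac{|M_{F,T}|}{|\mathrm{Aut}(T)|}\,T$, where $|M_{F,T}|$ is the homotopy cardinality of the homotopy fibre of $M\to\mathbf F\times\mathbf T$ over $(F,T)$. Then: 1. The map $1+P(\mathbf T)\to\mathbf T$ given by the trivial trees and by grafting is an equivalence of groupoids. 2. For $B_+$ and for each $B_+^b$,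 each tree $T$ has a non-zero coefficient in the image of only finitely many isomorphism classes of forests, so that these operators extend to formal series; and $B_+$ is the homotopy sum of the individual operators: $$B_+=\sum_{b\in\pi_0B}\frac{1}{|\mathrm{Aut}(b)|}\,B_+^b .$$ 3. $G$ solves the internalised Dyson–Schwinger equation $$G=\mathbf 1+B_+(\exp G),$$ or, written out with $n_b=|E_b|$, $$G=\mathbf 1+\sum_{b\in\pi_0 B}\frac{1}{|\mathrm{Aut}(b)|\;n_b!}\,B_+^b\bigl(G^{n_b}\bigr).$$ -/

import Mathlib

open CategoryTheory

universe v₁ v₂ v₃ u₁ u₂ u₃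

/-- `π₀ C`: the set of isomorphism classes of objects (for a groupoid, its components). -/
abbrev Pi0 (C : Type*) [Category C] : Type _ := Quotient (isIsomorphicSetoid C)

/-- Homotopy cardinality of a groupoid: `∑_{x ∈ π₀ C} 1 / |Aut x|`. -/
noncomputable def hcard (C : Type*) [Category C] : ℚ :=
  ∑ᶠ x : Pi0 C, ((Nat.card (Aut x.out) : ℚ))⁻¹

/-- A polynomial endofunctor over groupoids, given by its representing diagram
`I ←s- E -p→ B -t→ I`. -/
structure PolyEndo (I : Type u₁) (E : Type u₂) (B : Type u₃)
    [Groupoid.{v₁} I] [Groupoid.{v₂} E] [Groupoid.{v₃} B] where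
  s : E ⥤ I
  p : E ⥤ B
  t : B ⥤ I

namespace PolyEndo

variable {I : Type u₁} {E : Type u₂} {B : Type u₃}
  [Groupoid.{v₁} I] [Groupoid.{v₂} E] [Groupoid.{v₃} B]

/-- The homotopy fibre `E_b` of `p` over `b`: objects are pairs `(e, p e ⟶ b)`. -/
abbrev Fib (P : PolyEndo I E B) (b : B) : Type _ := CostructuredArrow P.p b

/-- `p` has finite discrete homotopy fibres. -/
def Finitary (P : PolyEndo I E B) : Prop :=
  ∀ b : B, Quiver.IsThin (P.Fib b) ∧ Finite (Pi0 (P.Fib b))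

/-- The arity of an operation: the size of the finite discrete groupoid `E_b`. -/
noncomputable def arity (P : PolyEndo I E B) (b : B) : ℕ := Nat.card (Pi0 (P.Fib b))

end PolyEndo

/-- A finite rooted operadic tree, i.e. a diagram of finite sets `A ← M → N → A`, where `M` is
presented as the disjoint union of its fibres `M n` over the nodes. (`N` and `M` are finite
because they inject into `A`.) -/
structure RTree where
  /-- edges -/
  A : Type
  /-- nodes -/
  N : Type
  /-- input edges of a node -/
  M : N → Type
  finA : Finite A
  ins : ∀ n, M n → A
  out : N → A
  root : A
  out_inj : Function.Injective out
  ins_inj : Function.Injective (fun x : (Σ n, M n) => ins x.1 x.2)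
  /-- the complement of the image of `M → A` is exactly the root -/
  ins_range : ∀ x, x ≠ root ↔ ∃ n m, ins n m = x
  /-- walking down (from an input edge of a node to its output edge) one reaches the root -/
  walk : ∀ x, Relation.ReflTransGen (fun x y => ∃ n m, ins n m = x ∧ out n = y) x root

section

variable {I : Type u₁} {E : Type u₂} {B : Type u₃}
  [Groupoid.{v₁} I] [Groupoid.{v₂} E] [Groupoid.{v₃} B]

/-- A `P`-tree: a tree together with a map of diagrams to `I ← E → B → I`, whose squares commute
up to specified isomorphism and whose middle square is a homotopy pullback. The latter says that
for each node `n`, decorated by `b`, the map from the set of input edges of `n` to the discrete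
groupoid `E_b` is an equivalence. -/
structure PTree (P : PolyEndo I E B) extends RTree where
  colour : A → I
  label : N → B
  slot : ∀ n, M n → E
  insIso : ∀ n m, colour (ins n m) ⟶ P.s.obj (slot n m)
  midIso : ∀ n m, P.p.obj (slot n m) ⟶ label n
  outIso : ∀ n, colour (out n) ⟶ P.t.obj (label n)
  cart : ∀ n, Function.Bijective
    (fun m : M n => (Quotient.mk _ (CostructuredArrow.mk (midIso n m)) : Pi0 (P.Fib (label n))))

namespace PTree

variable {P : PolyEndo I E B}

/-- Isomorphisms of `P`-trees: an isomorphism of the underlying trees and, on decorations,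
arrows of `I`, `B`, `E` compatible with the specified isomorphisms of the three squares. -/
@[ext]
structure Hom (S T : PTree P) where
  edge : S.A → T.A
  node : S.N → T.N
  inp : ∀ n, S.M n → T.M (node n)
  edge_bij : Function.Bijective edge
  node_bij : Function.Bijective node
  inp_bij : ∀ n, Function.Bijective (inp n)
  edge_ins : ∀ n m, edge (S.ins n m) = T.ins (node n) (inp n m)
  edge_out : ∀ n, edge (S.out n) = T.out (node n)
  onEdge : ∀ x, S.colour x ⟶ T.colour (edge x)
  onNode : ∀ n, S.label n ⟶ T.label (node n)
  onSlot : ∀ n m, S.slot n m ⟶ T.slot (node n) (inp n m)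
  comm_ins : ∀ n m, S.insIso n m ≫ P.s.map (onSlot n m) =
    onEdge (S.ins n m) ≫ eqToHom (congrArg T.colour (edge_ins n m)) ≫
      T.insIso (node n) (inp n m)
  comm_mid : ∀ n m, S.midIso n m ≫ onNode n =
    P.p.map (onSlot n m) ≫ T.midIso (node n) (inp n m)
  comm_out : ∀ n, S.outIso n ≫ P.t.map (onNode n) =
    onEdge (S.out n) ≫ eqToHom (congrArg T.colour (edge_out n)) ≫ T.outIso (node n)

theorem Hom.ext_heq {S T : PTree P} {f g : Hom S T} (h₁ : ∀ x, f.edge x = g.edge x)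
    (h₂ : ∀ n, f.node n = g.node n) (h₃ : ∀ n m, f.inp n m ≍ g.inp n m)
    (h₄ : ∀ x, f.onEdge x ≍ g.onEdge x) (h₅ : ∀ n, f.onNode n ≍ g.onNode n)
    (h₆ : ∀ n m, f.onSlot n m ≍ g.onSlot n m) : f = g := by
  obtain ⟨e, n, i⟩ := f
  obtain ⟨e', n', i'⟩ := g
  obtain rfl : e = e' := funext h₁
  obtain rfl : n = n' := funext h₂
  obtain rfl : i = i' := funext fun n => funext fun m => eq_of_heq (h₃ n m)
  congr
  · exact funext fun x => eq_of_heq (h₄ x)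
  · exact funext fun x => eq_of_heq (h₅ x)
  · exact funext fun n => funext fun m => eq_of_heq (h₆ n m)

theorem Hom.onEdge_eqToHom {S T : PTree P} (f : Hom S T) {x y : S.A} (h : x = y) :
    eqToHom (congrArg S.colour h) ≫ f.onEdge y =
      f.onEdge x ≫ eqToHom (congrArg (fun z => T.colour (f.edge z)) h) := by
  subst h; simp

theorem Hom.edge_root {S T : PTree P} (f : Hom S T) : f.edge S.root = T.root := by
  by_contra h
  obtain ⟨n, m, hm⟩ := (T.ins_range _).1 h
  obtain ⟨n, rfl⟩ := f.node_bij.2 n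
  obtain ⟨m, rfl⟩ := (f.inp_bij n).2 m
  rw [← f.edge_ins] at hm
  exact (S.ins_range _).2 ⟨n, m, f.edge_bij.1 hm⟩ rfl

/-- Identity. -/
def Hom.id (S : PTree P) : Hom S S where
  edge x := x
  node n := n
  inp _ m := m
  edge_bij := Function.bijective_id
  node_bij := Function.bijective_id
  inp_bij _ := Function.bijective_id
  edge_ins _ _ := rfl
  edge_out _ := rfl
  onEdge _ := 𝟙 _
  onNode _ := 𝟙 _
  onSlot _ _ := 𝟙 _
  comm_ins _ _ := by simp
  comm_mid _ _ := by simp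
  comm_out _ := by simp

/-- Composition. -/
def Hom.comp {S T U : PTree P} (f : Hom S T) (g : Hom T U) : Hom S U where
  edge x := g.edge (f.edge x)
  node n := g.node (f.node n)
  inp n m := g.inp (f.node n) (f.inp n m)
  edge_bij := g.edge_bij.comp f.edge_bij
  node_bij := g.node_bij.comp f.node_bij
  inp_bij n := (g.inp_bij (f.node n)).comp (f.inp_bij n)
  edge_ins n m := by rw [f.edge_ins, g.edge_ins]
  edge_out n := by rw [f.edge_out, g.edge_out]
  onEdge x := f.onEdge x ≫ g.onEdge (f.edge x)
  onNode n := f.onNode n ≫ g.onNode (f.node n)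
  onSlot n m := f.onSlot n m ≫ g.onSlot (f.node n) (f.inp n m)
  comm_ins n m := by
    have h := g.onEdge_eqToHom (f.edge_ins n m)
    have h2 := g.comm_ins (f.node n) (f.inp n m)
    simp only [Functor.map_comp, Category.assoc]
    rw [reassoc_of% (f.comm_ins n m), h2, reassoc_of% h]
    simp
  comm_mid n m := by
    simp only [Functor.map_comp, Category.assoc]
    rw [reassoc_of% (f.comm_mid n m), g.comm_mid]
  comm_out n := by
    have h := g.onEdge_eqToHom (f.edge_out n)
    simp only [Functor.map_comp, Category.assoc]
    rw [reassoc_of% (f.comm_out n), g.comm_out, reassoc_of% h]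
    simp

/-- The groupoid `𝐓` of `P`-trees (all its arrows are invertible). -/
instance : Category (PTree P) where
  Hom := Hom
  id := Hom.id
  comp := Hom.comp
  id_comp f := by
    refine Hom.ext rfl rfl HEq.rfl ?_ ?_ ?_ <;>
      simp [Hom.comp, Hom.id]
  comp_id f := by
    refine Hom.ext rfl rfl HEq.rfl ?_ ?_ ?_ <;>
      simp [Hom.comp, Hom.id]
  assoc f g h := by
    refine Hom.ext rfl rfl HEq.rfl ?_ ?_ ?_ <;>
      simp [Hom.comp]

/-- The structure map `𝐓 → I`: the decoration of the root edge. -/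
def rootColour (P : PolyEndo I E B) : PTree P ⥤ I where
  obj T := T.colour T.root
  map {S T} f := Hom.onEdge f S.root ≫ eqToHom (congrArg T.colour (Hom.edge_root f))
  map_id S := by simp [CategoryStruct.id, Hom.id]
  map_comp {S T U} f g := by
    have h := Hom.onEdge_eqToHom g (Hom.edge_root f)
    simp only [Category.assoc]
    rw [reassoc_of% h]
    simp [CategoryStruct.comp, Hom.comp]

/-- The trivial `P`-tree consisting of a single edge of a given colour. -/
def triv (P : PolyEndo I E B) : I ⥤ PTree P where
  obj i :=
    { A := PUnit
      N := PEmpty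
      M := PEmpty.elim
      finA := inferInstance
      ins := fun n => n.elim
      out := PEmpty.elim
      root := PUnit.unit
      out_inj := fun n => n.elim
      ins_inj := fun n => n.1.elim
      ins_range := fun x => ⟨fun h => (h rfl).elim, fun ⟨n, _⟩ => n.elim⟩
      walk := fun _ => Relation.ReflTransGen.refl
      colour := fun _ => i
      label := PEmpty.elim
      slot := fun n => n.elim
      insIso := fun n => n.elim
      midIso := fun n => n.elim
      outIso := fun n => n.elim
      cart := fun n => n.elim }
  map f :=
    { edge := fun x => x
      node := fun n => n
      inp := fun n => n.elim
      edge_bij := Function.bijective_id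
      node_bij := Function.bijective_id
      inp_bij := fun n => n.elim
      edge_ins := fun n => n.elim
      edge_out := fun n => n.elim
      onEdge := fun _ => f
      onNode := fun n => n.elim
      onSlot := fun n => n.elim
      comm_ins := fun n => n.elim
      comm_mid := fun n => n.elim
      comm_out := fun n => n.elim }
  map_id i := by
    refine Hom.ext rfl rfl (heq_of_eq (funext fun n => n.elim)) HEq.rfl
      (heq_of_eq (funext fun n => n.elim)) ?_
    exact Function.hfunext rfl (fun n => n.elim)
  map_comp f g := by
    refine Hom.ext rfl rfl (heq_of_eq (funext fun n => n.elim)) HEq.rfl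
      (heq_of_eq (funext fun n => n.elim)) ?_
    exact Function.hfunext rfl (fun n => n.elim)

end PTree

/-- A `P`-forest: a finite family (disjoint union) of `P`-trees. -/
structure PForest (P : PolyEndo I E B) where
  ι : Type
  fin : Finite ι
  tree : ι → PTree P

namespace PForest

variable {P : PolyEndo I E B}

/-- Isomorphisms of forests. -/
@[ext]
structure Hom (F G : PForest P) where
  perm : F.ι → G.ι
  perm_bij : Function.Bijective perm
  iso : ∀ i, F.tree i ⟶ G.tree (perm i)

/-- The groupoid `𝐅` of `P`-forests. -/
instance : Category (PForest P) where
  Hom := Hom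
  id F := ⟨fun i => i, Function.bijective_id, fun _ => 𝟙 _⟩
  comp f g := ⟨fun i => g.perm (f.perm i), g.perm_bij.comp f.perm_bij,
    fun i => f.iso i ≫ g.iso (f.perm i)⟩
  id_comp f := Hom.ext rfl (by simp)
  comp_id f := Hom.ext rfl (by simp)
  assoc f g h := Hom.ext rfl (by simp)

/-- The monomial in isomorphism classes of `P`-trees which represents a forest. -/
noncomputable def monomial (F : PForest P) : Pi0 (PTree P) →₀ ℕ :=
  ∑ᶠ i : F.ι, Finsupp.single (Quotient.mk _ (F.tree i)) 1

end PForest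

/-- The groupoid `P(X)` of `X`-decorated `P`-corollas, for `X` a groupoid over `I`: an operation
`b` and a map `E_b → X` over `I`. As `E_b` is finite and discrete, such a map is given by a
finite set `ι` with an equivalence `ι ≃ E_b`, a family `ι → X`, and isomorphisms of colours. -/
structure PolyEndo.Eval (P : PolyEndo I E B) {X : Type*} [Category X] (c : X ⥤ I) where
  op : B
  ι : Type
  fin : Finite ι
  deco : ι → X
  slot : ι → E
  midIso : ∀ i, P.p.obj (slot i) ⟶ op
  cart : Function.Bijective
    (fun i : ι => (Quotient.mk _ (CostructuredArrow.mk (midIso i)) : Pi0 (P.Fib op)))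
  insIso : ∀ i, c.obj (deco i) ⟶ P.s.obj (slot i)

namespace PolyEndo

namespace Eval

variable {P : PolyEndo I E B} {X : Type*} [Category X] {c : X ⥤ I}

/-- Arrows of `P(X)`: an arrow `β` of `B` together with a 2-cell over `I` which compares the two
decorations along `β_! : E_b → E_{b'}`. -/
@[ext]
structure Hom (x y : P.Eval c) where
  onOp : x.op ⟶ y.op
  perm : x.ι → y.ι
  perm_bij : Function.Bijective perm
  onDeco : ∀ i, x.deco i ⟶ y.deco (perm i)
  onSlot : ∀ i, x.slot i ⟶ y.slot (perm i)
  comm_mid : ∀ i, x.midIso i ≫ onOp = P.p.map (onSlot i) ≫ y.midIso (perm i)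
  comm_ins : ∀ i, x.insIso i ≫ P.s.map (onSlot i) = c.map (onDeco i) ≫ y.insIso (perm i)

instance : Category (P.Eval c) where
  Hom := Hom
  id x := ⟨𝟙 _, fun i => i, Function.bijective_id, fun _ => 𝟙 _, fun _ => 𝟙 _, by simp, by simp⟩
  comp f g :=
    { onOp := f.onOp ≫ g.onOp
      perm := fun i => g.perm (f.perm i)
      perm_bij := g.perm_bij.comp f.perm_bij
      onDeco := fun i => f.onDeco i ≫ g.onDeco (f.perm i)
      onSlot := fun i => f.onSlot i ≫ g.onSlot (f.perm i)
      comm_mid := fun i => by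
        simp only [Functor.map_comp, Category.assoc]
        rw [reassoc_of% (f.comm_mid i), g.comm_mid]
      comm_ins := fun i => by
        simp only [Functor.map_comp, Category.assoc]
        rw [reassoc_of% (f.comm_ins i), g.comm_ins] }
  id_comp f := Hom.ext (by simp) rfl (by simp) (by simp)
  comp_id f := Hom.ext (by simp) rfl (by simp) (by simp)
  assoc f g h := Hom.ext (by simp) rfl (by simp) (by simp)

/-- The projection `P(X) → B`. -/
def toOp (c : X ⥤ I) : P.Eval c ⥤ B where
  obj x := x.op
  map f := Hom.onOp f

end Eval

variable (P : PolyEndo I E B)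

/-- `P(𝐓)`. An object is an `E_b`-indexed family of trees, or equivalently a forest together with
a bijection, compatible with colours, from its roots to the leaves of the corolla `b`; so this is
also the homotopy fibre product of `𝐅` and `B` over the groupoid of nodeless forests. -/
abbrev EvalT : Type _ := P.Eval (PTree.rootColour P)

/-- The projection `P(𝐓) → 𝐅`. -/
def toForest : P.EvalT ⥤ PForest P where
  obj x := ⟨x.ι, x.fin, x.deco⟩
  map f := ⟨Eval.Hom.perm f, Eval.Hom.perm_bij f, Eval.Hom.onDeco f⟩

variable {P}

/-- Input edges of the nodes of a grafted tree. -/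
def graftM (x : P.EvalT) : Option (Σ i, (x.deco i).N) → Type
  | none => x.ι
  | some n => (x.deco n.1).M n.2

/-- Grafting a family of trees onto a corolla: there is one new edge (the root), and one new
node, whose input edges are the roots of the given trees. -/
def graftObj (x : P.EvalT) : PTree P where
  A := Option (Σ i, (x.deco i).A)
  N := Option (Σ i, (x.deco i).N)
  M := graftM x
  finA := by
    have := x.fin
    have := fun i => (x.deco i).finA
    infer_instance
  ins n := match n with
    | none => fun i : x.ι => some ⟨i, (x.deco i).root⟩
    | some n => fun m => some ⟨n.1, (x.deco n.1).ins n.2 m⟩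
  out n := n.map fun n => ⟨n.1, (x.deco n.1).out n.2⟩
  root := none
  out_inj := by
    rintro (_ | ⟨i, n⟩) (_ | ⟨j, m⟩) h
    · rfl
    · simp at h
    · simp at h
    · simp only [Option.map_some, Option.some.injEq, Sigma.mk.injEq] at h
      obtain ⟨rfl, h⟩ := h
      rw [(x.deco i).out_inj (eq_of_heq h)]
  ins_inj := by
    rintro ⟨_ | ⟨i, n⟩, m⟩ ⟨_ | ⟨j, n'⟩, m'⟩ h
    · have h1 := (Sigma.mk.injEq _ _ _ _).mp (Option.some.inj h)
      rw [show m = m' from h1.1]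
    · obtain ⟨h1, h⟩ := (Sigma.mk.injEq _ _ _ _).mp (Option.some.inj h)
      subst h1
      exact (((x.deco m).ins_range _).2 ⟨n', m', (eq_of_heq h).symm⟩ rfl).elim
    · obtain ⟨h1, h⟩ := (Sigma.mk.injEq _ _ _ _).mp (Option.some.inj h)
      subst h1
      exact (((x.deco i).ins_range _).2 ⟨n, m, eq_of_heq h⟩ rfl).elim
    · obtain ⟨h1, h⟩ := (Sigma.mk.injEq _ _ _ _).mp (Option.some.inj h)
      subst h1
      have h' := (x.deco i).ins_inj (a₁ := ⟨n, m⟩) (a₂ := ⟨n', m'⟩) (eq_of_heq h)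
      cases h'
      rfl
  ins_range := by
    rintro (_ | ⟨i, a⟩)
    · simp only [ne_eq, not_true_eq_false, false_iff, not_exists]
      rintro (_ | n) m h <;> cases h
    · simp only [ne_eq, reduceCtorEq, not_false_eq_true, true_iff]
      by_cases ha : a = (x.deco i).root
      · subst ha
        exact ⟨none, i, rfl⟩
      · obtain ⟨n, m, rfl⟩ := ((x.deco i).ins_range a).1 ha
        exact ⟨some ⟨i, n⟩, m, rfl⟩
  walk := by
    rintro (_ | ⟨i, a⟩)
    · exact Relation.ReflTransGen.refl
    · refine Relation.ReflTransGen.tail (b := some ⟨i, (x.deco i).root⟩) ?_ ⟨none, i, rfl, rfl⟩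
      refine Relation.ReflTransGen.lift
        (fun a => (some ⟨i, a⟩ : Option (Σ i, (x.deco i).A))) ?_ _ _ ((x.deco i).walk a)
      rintro a b ⟨n, m, rfl, rfl⟩
      exact ⟨some ⟨i, n⟩, m, rfl, rfl⟩
  colour a := match a with
    | none => P.t.obj x.op
    | some a => (x.deco a.1).colour a.2
  label n := match n with
    | none => x.op
    | some n => (x.deco n.1).label n.2
  slot n := match n with
    | none => fun i : x.ι => x.slot i
    | some n => fun m => (x.deco n.1).slot n.2 m
  insIso n := match n with
    | none => fun i : x.ι => x.insIso i
    | some n => fun m => (x.deco n.1).insIso n.2 m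
  midIso n := match n with
    | none => fun i : x.ι => x.midIso i
    | some n => fun m => (x.deco n.1).midIso n.2 m
  outIso n := match n with
    | none => 𝟙 _
    | some n => (x.deco n.1).outIso n.2
  cart n := match n with
    | none => x.cart
    | some n => (x.deco n.1).cart n.2

theorem bijective_optionSigma {ι κ : Type} {A : ι → Type} {A' : κ → Type} {σ : ι → κ}
    (hσ : Function.Bijective σ) (f : ∀ i, A i → A' (σ i)) (hf : ∀ i, Function.Bijective (f i)) :
    Function.Bijective (Option.map (Sigma.map σ f)) := by
  have : Function.Bijective (Sigma.map σ f) :=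
    ⟨hσ.1.sigma_map fun i => (hf i).1, hσ.2.sigma_map fun i => (hf i).2⟩
  exact (Equiv.optionCongr (Equiv.ofBijective _ this)).bijective

/-- Grafting `P(𝐓) → 𝐓`: the `P(𝐓)`-part of the structure equivalence `𝐓 ≃ 1 + P(𝐓)`. -/
def graft (P : PolyEndo I E B) : P.EvalT ⥤ PTree P where
  obj := graftObj
  map {x y} f :=
    { edge := Option.map (Sigma.map (Eval.Hom.perm f) fun i => (Eval.Hom.onDeco f i).edge)
      node := Option.map (Sigma.map (Eval.Hom.perm f) fun i => (Eval.Hom.onDeco f i).node)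
      inp := fun n => match n with
        | none => Eval.Hom.perm f
        | some n => (Eval.Hom.onDeco f n.1).inp n.2
      edge_bij := bijective_optionSigma (Eval.Hom.perm_bij f) _
        fun i => (Eval.Hom.onDeco f i).edge_bij
      node_bij := bijective_optionSigma (Eval.Hom.perm_bij f) _
        fun i => (Eval.Hom.onDeco f i).node_bij
      inp_bij := fun n => match n with
        | none => Eval.Hom.perm_bij f
        | some n => (Eval.Hom.onDeco f n.1).inp_bij n.2
      edge_ins := fun n => match n with
        | none => fun i => congrArg (fun a => some (Sigma.mk _ a)) (Eval.Hom.onDeco f i).edge_root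
        | some n => fun m => congrArg (fun a => some (Sigma.mk _ a))
            ((Eval.Hom.onDeco f n.1).edge_ins n.2 m)
      edge_out := fun n => match n with
        | none => rfl
        | some n => congrArg (fun a => some (Sigma.mk _ a)) ((Eval.Hom.onDeco f n.1).edge_out n.2)
      onEdge := fun a => match a with
        | none => P.t.map (Eval.Hom.onOp f)
        | some a => (Eval.Hom.onDeco f a.1).onEdge a.2
      onNode := fun n => match n with
        | none => Eval.Hom.onOp f
        | some n => (Eval.Hom.onDeco f n.1).onNode n.2
      onSlot := fun n => match n with
        | none => fun i => Eval.Hom.onSlot f i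
        | some n => fun m => (Eval.Hom.onDeco f n.1).onSlot n.2 m
      comm_ins := fun n => match n with
        | none => fun i => (Eval.Hom.comm_ins f i).trans (Category.assoc _ _ _)
        | some n => fun m => (Eval.Hom.onDeco f n.1).comm_ins n.2 m
      comm_mid := fun n => match n with
        | none => fun i => Eval.Hom.comm_mid f i
        | some n => fun m => (Eval.Hom.onDeco f n.1).comm_mid n.2 m
      comm_out := fun n => match n with
        | none => (Category.id_comp _).trans
            ((Category.comp_id _).symm.trans (congrArg _ (Category.comp_id _).symm))
        | some n => (Eval.Hom.onDeco f n.1).comm_out n.2 }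
  map_id x := PTree.Hom.ext_heq (by rintro (_ | _) <;> rfl) (by rintro (_ | _) <;> rfl)
    (by rintro (_ | _) m <;> rfl)
    (by rintro (_ | _); exacts [heq_of_eq (P.t.map_id _), HEq.rfl])
    (by rintro (_ | _) <;> rfl) (by rintro (_ | _) m <;> rfl)
  map_comp f g := PTree.Hom.ext_heq (by rintro (_ | _) <;> rfl) (by rintro (_ | _) <;> rfl)
    (by rintro (_ | _) m <;> rfl)
    (by rintro (_ | _); exacts [heq_of_eq (P.t.map_comp _ _), HEq.rfl])
    (by rintro (_ | _) <;> rfl) (by rintro (_ | _) m <;> rfl)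

variable (P)

/-- The structure map `1 + P(𝐓) → 𝐓`: on the terminal object `1 = (I → I)` of the slice over `I`
it is the inclusion of the trivial trees, and on `P(𝐓)` it is grafting. -/
def structureMap : I ⊕ P.EvalT ⥤ PTree P :=
  (PTree.triv P).sum' P.graft

/-- The completion of the free commutative algebra `ℚ[T ∈ π₀ 𝐓]` underlying the bialgebra of
`P`-trees: formal power series in the isomorphism classes of `P`-trees. -/
abbrev Completion : Type _ := MvPowerSeries (Pi0 (PTree P)) ℚ

variable {P}

/-- The formal sum `∑ₖ cₖ mₖ` of a family of scalar multiples of monomials, each monomial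
occurring only finitely often with nonzero coefficient. -/
noncomputable def formalSum {κ : Type*} (c : κ → ℚ) (m : κ → (Pi0 (PTree P) →₀ ℕ)) :
    P.Completion :=
  fun d => ∑ᶠ k, MvPowerSeries.coeff d (MvPowerSeries.monomial (m k) (c k))

variable (P)

/-- The Green function `G = ∑_{T ∈ π₀ 𝐓} T / |Aut T|`. -/
noncomputable def green : P.Completion :=
  formalSum (fun T : Pi0 (PTree P) => ((Nat.card (Aut T.out) : ℚ))⁻¹)
    (fun T => Finsupp.single T 1)

/-- The series of the terminal object `I → I`, pushed forward to `𝐓` along the inclusion of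
trivial trees: the sum, weighted by symmetry factors, of the trivial trees `∑ᵢ |ᵢ / |Aut i|`. -/
noncomputable def unitSeries : P.Completion :=
  formalSum (fun i : Pi0 I => ((Nat.card (Aut i.out) : ℚ))⁻¹)
    (fun i => Finsupp.single (Quotient.mk _ ((PTree.triv P).obj i.out)) 1)

variable {P}

/-- The matrix of the linear map which is the homotopy cardinality of the linear functor
(pullback along `L`, then lowershriek along `R`) of a span `𝐅 ←L- M -R→ 𝐓`: the
coefficient of `T` in the image of `F` is `|M_{F,T}| / |Aut T|`, where `M_{F,T}` is the homotopy
fibre of `(L, R) : M → 𝐅 × 𝐓`. -/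
noncomputable def spanCoeff {M : Type*} [Category M] (L : M ⥤ PForest P) (R : M ⥤ PTree P)
    (F : Pi0 (PForest P)) (T : Pi0 (PTree P)) : ℚ :=
  hcard (CostructuredArrow (L.prod' R) (F.out, T.out)) / Nat.card (Aut T.out)

/-- The linear operator on formal series given by a span `𝐅 ←L- M -R→ 𝐓`, where the
monomials are identified with the isomorphism classes of forests. -/
noncomputable def spanOp {M : Type*} [Category M] (L : M ⥤ PForest P) (R : M ⥤ PTree P)
    (f : P.Completion) : P.Completion :=
  formalSum
    (fun T : Pi0 (PTree P) =>
      ∑ᶠ F : Pi0 (PForest P), MvPowerSeries.coeff F.out.monomial f * spanCoeff L R F T)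
    (fun T => Finsupp.single T 1)

variable (P)

/-- The global `B₊`-operator, given by the span `𝐅 ← P(𝐓) → 𝐓`. -/
noncomputable def bPlus : P.Completion → P.Completion :=
  spanOp P.toForest P.graft

/-- The homotopy fibre of `P(𝐓) → B` over `b`: forests with a bijection, compatible with
colours, from the roots to the leaves of the corolla `b`, i.e. `E_b`-indexed families of trees. -/
abbrev EvalTFib (b : B) : Type _ :=
  CostructuredArrow (Eval.toOp (P := P) (PTree.rootColour P)) b

/-- The left leg of the span defining the individual `B₊`-operator of `b`. -/
def toForestFib (b : B) : P.EvalTFib b ⥤ PForest P :=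
  CostructuredArrow.proj _ _ ⋙ P.toForest

/-- The right leg of the span defining the individual `B₊`-operator of `b`: grafting onto `b`. -/
def graftFib (b : B) : P.EvalTFib b ⥤ PTree P :=
  CostructuredArrow.proj _ _ ⋙ P.graft

/-- The individual `B₊`-operator of an operation `b`, given by the span `𝐅 ← P(𝐓)_b → 𝐓`. -/
noncomputable def bPlusAt (b : B) : P.Completion → P.Completion :=
  spanOp (P.toForestFib b) (P.graftFib b)

/-- `exp G`, the sum `∑ F / |Aut F|` of all forests. -/
noncomputable def expGreen : P.Completion :=
  PowerSeries.subst P.green (PowerSeries.exp ℚ)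

end PolyEndo

end

/-! A tree is either a bare edge or has a root node. In the second case, cutting at that node gives
an operation with a family of trees on its inputs, and every isomorphism of trees respects the cut.
Hence `structureMap` is an equivalence, and in particular grafting is fully faithful.

Full faithfulness of the right leg makes the homotopy fibres of the spans discrete. If `T` is the
graft of `x` and `F₀` is the forest of `x`, the fibre over `(F, T)` is the set of isomorphisms `F₀ ⟶
F`. So row `T` of `B₊` has a single non-zero entry, `|Aut F₀| / |Aut T|`, in column `F₀`; for `B₊^b`
there is the extra factor `|Hom(x.op, b)|`. Rows of trivial trees vanish. The sum of `|Hom(x.op, b)|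
/ |Aut b|` over the classes of `b` is 1, since only the class of `x.op` contributes; this gives the
homotopy sum formula.

It remains to know the coefficients of `exp G` and `G ^ n`. An automorphism of a forest permutes
isomorphic trees and acts on each of them, so `1 / |Aut F|` is the product of `g_T ^ k_T / k_T!`
with `g_T = 1 / |Aut T|`. By the multinomial theorem this is the coefficient of `F` in `exp G`, and
`n!` times it is the coefficient in `G ^ n` when `F` has `n` trees. Multiplying by `|Aut F₀| / |Aut
T|` leaves `1 / |Aut T|`, the coefficient of `T` in `G`; trivial trees are accounted for by
`unitSeries`. Finiteness of the vertex groups makes these cancellations legitimate. The carrying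
lemmas are `structureMap_isEquivalence`, `hcard_eq_card_presheaf`, `coeff_linear_pow` and
`PForest.card_aut`. -/

/-! ### Invertibility of morphisms of trees and forests, and finiteness of their hom-sets -/

section Groupoids

variable {I : Type u₁} {E : Type u₂} {B : Type u₃}
  [Groupoid.{v₁} I] [Groupoid.{v₂} E] [Groupoid.{v₃} B] {P : PolyEndo I E B}

namespace PTree

/-- All inverse data over one node are bundled in a single existential, so that `n'` can be replaced
by some `f.node n` before anything is chosen. The heterogeneous equalities record what survives once
`n` becomes a chosen preimage. -/
theorem Hom.exists_node_inv {S T : PTree P} (f : Hom S T) (n' : T.N) :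
    ∃ (n : S.N) (i : T.M n' → S.M n) (b : T.label n' ⟶ S.label n)
      (o : ∀ m, T.slot n' m ⟶ S.slot n (i m)),
      f.node n = n' ∧ Function.Bijective i ∧ (∀ m, f.inp n (i m) ≍ m) ∧
      b ≍ Groupoid.inv (f.onNode n) ∧
      (∀ m, o m ≍ Groupoid.inv (f.onSlot n (i m))) ∧
      f.edge (S.out n) = T.out n' ∧ (∀ m, f.edge (S.ins n (i m)) = T.ins n' m) ∧
      (∀ m, T.midIso n' m ≫ b = P.p.map (o m) ≫ S.midIso n (i m)) ∧
      (∀ h : T.colour (T.out n') = T.colour (f.edge (S.out n)),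
        T.outIso n' ≫ P.t.map b =
          eqToHom h ≫ Groupoid.inv (f.onEdge (S.out n)) ≫ S.outIso n) ∧
      ∀ m (h : T.colour (T.ins n' m) = T.colour (f.edge (S.ins n (i m)))),
        T.insIso n' m ≫ P.s.map (o m) =
          eqToHom h ≫ Groupoid.inv (f.onEdge (S.ins n (i m))) ≫ S.insIso n (i m) := by
  obtain ⟨n, rfl⟩ := f.node_bij.2 n'
  have key : ∀ m, ∃ (k : S.M n) (o : T.slot (f.node n) m ⟶ S.slot n k),
      f.inp n k = m ∧ o ≍ Groupoid.inv (f.onSlot n k) ∧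
      T.midIso (f.node n) m ≫ Groupoid.inv (f.onNode n) = P.p.map o ≫ S.midIso n k ∧
      ∀ h : T.colour (T.ins (f.node n) m) = T.colour (f.edge (S.ins n k)),
        T.insIso (f.node n) m ≫ P.s.map o =
          eqToHom h ≫ Groupoid.inv (f.onEdge (S.ins n k)) ≫ S.insIso n k := by
    intro m
    obtain ⟨k, rfl⟩ := (f.inp_bij n).2 m
    refine ⟨k, Groupoid.inv (f.onSlot n k), rfl, HEq.rfl, ?_, fun h => ?_⟩
    · have h := f.comm_mid n k
      simp only [Groupoid.inv_eq_inv, Functor.map_inv]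
      rw [IsIso.eq_inv_comp, ← Category.assoc, ← h, Category.assoc, IsIso.hom_inv_id,
        Category.comp_id]
    · have h' := f.comm_ins n k
      simp only [Groupoid.inv_eq_inv, Functor.map_inv]
      rw [← Category.assoc, IsIso.comp_inv_eq]
      simp only [Category.assoc, h']
      simp
  choose i o hi ho hmid hins using key
  refine ⟨n, i, Groupoid.inv (f.onNode n), o, rfl, ⟨fun a b h => ?_, fun k => ?_⟩,
    fun m => heq_of_eq (hi m), HEq.rfl, ho, f.edge_out n, ?_, hmid, ?_, hins⟩
  · rw [← hi a, ← hi b, h]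
  · exact ⟨f.inp n k, (f.inp_bij n).1 (hi _)⟩
  · intro m
    rw [f.edge_ins, hi]
  · intro h
    have h' := f.comm_out n
    simp only [Groupoid.inv_eq_inv, Functor.map_inv]
    rw [IsIso.comp_inv_eq]
    simp only [Category.assoc, h']
    simp

theorem Hom.exists_right_inv {S T : PTree P} (f : Hom S T) :
    ∃ g : Hom T S, f.comp g = Hom.id S := by
  choose e he using f.edge_bij.2
  choose ν i b o hν hib hi hb ho hout hins hmid hoc hic using f.exists_node_inv
  have hef : ∀ x y, f.edge x = y → e y = x := fun x y h => f.edge_bij.1 ((he y).trans h.symm)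
  have hνf : ∀ n, ν (f.node n) = n := fun n => f.node_bij.1 (hν _)
  have hinv : ∀ x y (h : x = y), Groupoid.inv (f.onEdge x) ≫ eqToHom (congrArg S.colour h) =
      eqToHom (congrArg (fun z => T.colour (f.edge z)) h) ≫ Groupoid.inv (f.onEdge y) := by
    rintro x _ rfl
    simp
  refine ⟨
    { edge := e
      node := ν
      inp := i
      edge_bij := ⟨fun x y h => by rw [← he x, ← he y, h], fun x => ⟨f.edge x, hef _ _ rfl⟩⟩
      node_bij := ⟨fun x y h => by rw [← hν x, ← hν y, h], fun x => ⟨f.node x, hνf x⟩⟩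
      inp_bij := hib
      edge_ins := fun n m => hef _ _ (hins n m)
      edge_out := fun n => hef _ _ (hout n)
      onEdge := fun y => eqToHom (congrArg T.colour (he y).symm) ≫ Groupoid.inv (f.onEdge (e y))
      onNode := b
      onSlot := o
      comm_ins := fun n m => ?_
      comm_mid := hmid
      comm_out := fun n => ?_ }, ?_⟩
  · rw [hic n m (congrArg T.colour (hins n m).symm), Category.assoc,
      reassoc_of% (hinv _ _ (hef _ _ (hins n m)))]
    simp
  · rw [hoc n (congrArg T.colour (hout n).symm), Category.assoc,
      reassoc_of% (hinv _ _ (hef _ _ (hout n)))]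
    simp
  -- The two sides are inputs of `ν (f.node n)` and of `n`, which are only propositionally equal;
  -- the value of `i` is generalised so that `hνf` can be rewritten.
  · have hif : ∀ n m, i (f.node n) (f.inp n m) ≍ m := by
      intro n m
      have h := hi (f.node n) (f.inp n m)
      revert h
      generalize i (f.node n) (f.inp n m) = k
      revert k
      rw [hνf n]
      intro k h
      rw [(f.inp_bij n).1 (eq_of_heq h)]
    refine Hom.ext_heq (fun x => hef _ _ rfl) hνf hif ?_ ?_ ?_
    · intro x
      have : ∀ y (h : y = x), f.onEdge x ≫ eqToHom
          (congrArg (fun z => T.colour (f.edge z)) h.symm) ≫ Groupoid.inv (f.onEdge y) ≍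
          𝟙 (S.colour x) := by
        rintro _ rfl
        simp
      exact this _ (hef _ _ rfl)
    · intro n
      have : ∀ n' (b : T.label (f.node n) ⟶ S.label n'), n' = n →
          b ≍ Groupoid.inv (f.onNode n') → f.onNode n ≫ b ≍ 𝟙 (S.label n) := by
        rintro _ b rfl h
        rw [eq_of_heq h]
        simp
      exact this _ _ (hνf n) (hb _)
    · intro n m
      have : ∀ n' (k : S.M n') (o : T.slot (f.node n) (f.inp n m) ⟶ S.slot n' k), n' = n →
          k ≍ m → o ≍ Groupoid.inv (f.onSlot n' k) → f.onSlot n m ≫ o ≍ 𝟙 (S.slot n m) := by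
        rintro _ k o rfl hk h
        obtain rfl := eq_of_heq hk
        rw [eq_of_heq h]
        simp
      exact this _ _ _ (hνf n) (hif n m) (ho _ _)

/-- A one-sided inverse for every morphism suffices: the right inverse `g` of `f` has itself a right
inverse `h`, and then `f = h`. -/
theorem isIso {S T : PTree P} (f : S ⟶ T) : IsIso f := by
  obtain ⟨g, hg⟩ := Hom.exists_right_inv f
  obtain ⟨h, hh⟩ := Hom.exists_right_inv g
  change f ≫ g = 𝟙 S at hg
  change g ≫ h = 𝟙 T at hh
  have : f = h := by rw [← Category.comp_id f, ← hh, ← Category.assoc, hg, Category.id_comp]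
  exact ⟨g, hg, this ▸ hh⟩

theorem finite_N (T : PTree P) : Finite T.N :=
  have := T.finA
  Finite.of_injective _ T.out_inj

theorem finite_M (T : PTree P) (n : T.N) : Finite (T.M n) :=
  have := T.finA
  Finite.of_injective (T.ins n) fun a b h => by
    have h' := T.ins_inj (a₁ := ⟨n, a⟩) (a₂ := ⟨n, b⟩) h
    cases h'
    rfl

end PTree

theorem finite_hom_of_finite_aut {C : Type*} [Category C] (hC : ∀ x : C, Finite (Aut x))
    (hiso : ∀ {x y : C} (f : x ⟶ y), IsIso f) (x y : C) : Finite (x ⟶ y) := by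
  rcases isEmpty_or_nonempty (x ⟶ y) with h | ⟨⟨f⟩⟩
  · infer_instance
  · have := hC x
    have := hiso f
    refine Finite.of_injective (β := Aut x)
      (fun g => have := hiso g; asIso (g ≫ inv f)) fun g g' h => ?_
    have h' := congrArg Iso.hom h
    simpa using h'

/-- A morphism is determined by its maps of finite sets and its arrows in `I` and `B`; the arrows in
`E` are then forced, so no finiteness of the vertex groups of `E` is required. -/
theorem PTree.finite_hom (hP : P.Finitary) (hI : ∀ i : I, Finite (Aut i))
    (hB : ∀ b : B, Finite (Aut b)) (S T : PTree P) : Finite (S ⟶ T) := by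
  have hI' := finite_hom_of_finite_aut hI (fun _ => inferInstance)
  have hB' := finite_hom_of_finite_aut hB (fun _ => inferInstance)
  have := S.finA
  have := T.finA
  have := S.finite_N
  have := T.finite_N
  have := fun n => S.finite_M n
  have := fun n => T.finite_M n
  refine Finite.of_injective
    (β := Σ (e : S.A → T.A) (ν : S.N → T.N),
      (∀ n, S.M n → T.M (ν n)) × (∀ x, S.colour x ⟶ T.colour (e x)) ×
        (∀ n, S.label n ⟶ T.label (ν n)))
    (fun f => ⟨PTree.Hom.edge f, PTree.Hom.node f, PTree.Hom.inp f, PTree.Hom.onEdge f,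
      PTree.Hom.onNode f⟩) fun f g h => ?_
  obtain ⟨e, ν, i, he, hν, hi, h1, h2, oe, on, os, c1, c2, c3⟩ := f
  obtain ⟨e', ν', i', he', hν', hi', h1', h2', oe', on', os', c1', c2', c3'⟩ := g
  obtain ⟨rfl, h⟩ := (Sigma.mk.injEq _ _ _ _).mp h
  obtain ⟨rfl, h⟩ := (Sigma.mk.injEq _ _ _ _).mp (eq_of_heq h)
  obtain ⟨rfl, h⟩ := (Prod.mk.injEq _ _ _ _).mp (eq_of_heq h)
  obtain ⟨rfl, rfl⟩ := (Prod.mk.injEq _ _ _ _).mp h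
  -- The square `comm_mid` turns both slot arrows into parallel arrows of the homotopy fibre over
  -- the label, which is thin.
  obtain rfl : os = os' := by
    funext n m
    have := (hP (T.label (ν n))).1
    have h := c2 n m
    have h' := c2' n m
    let a : CostructuredArrow.mk (S.midIso n m ≫ on n) ⟶
      CostructuredArrow.mk (T.midIso (ν n) (i n m)) :=
      CostructuredArrow.homMk (os n m) h.symm
    let a' : CostructuredArrow.mk (S.midIso n m ≫ on n) ⟶
      CostructuredArrow.mk (T.midIso (ν n) (i n m)) :=
      CostructuredArrow.homMk (os' n m) h'.symm
    exact congrArg CommaMorphism.left (Subsingleton.elim a a')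
  rfl

namespace PForest

theorem isIso {F G : PForest P} (f : F ⟶ G) : IsIso f := by
  have right : ∀ {F G : PForest P} (f : F ⟶ G), ∃ g : G ⟶ F, f ≫ g = 𝟙 F := by
    intro F G f
    choose q hq using (Hom.perm_bij f).2
    have key : ∀ j, ∃ a : G.tree j ⟶ F.tree (q j),
        a ≍ (have := PTree.isIso (Hom.iso f (q j)); inv (Hom.iso f (q j))) := by
      intro j
      have := hq j
      revert this
      generalize q j = i
      rintro rfl
      exact ⟨_, HEq.rfl⟩
    choose a ha using key
    have hqf : ∀ i, q (Hom.perm f i) = i := fun i => (Hom.perm_bij f).1 (hq _)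
    refine ⟨⟨q, ⟨fun x y h => by rw [← hq x, ← hq y, h], fun x => ⟨_, hqf x⟩⟩, a⟩, ?_⟩
    refine Hom.ext (funext hqf) (Function.hfunext rfl ?_)
    rintro i _ ⟨⟩
    have : ∀ j (a : G.tree (Hom.perm f i) ⟶ F.tree j), j = i →
        (a ≍ (have := PTree.isIso (Hom.iso f j); inv (Hom.iso f j))) →
        Hom.iso f i ≫ a ≍ 𝟙 (F.tree i) := by
      rintro j a rfl h
      have := PTree.isIso (Hom.iso f j)
      rw [eq_of_heq h, IsIso.hom_inv_id]
    exact this _ _ (hqf i) (ha _)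
  obtain ⟨g, hg⟩ := right f
  obtain ⟨h, hh⟩ := right g
  have : f = h := by rw [← Category.comp_id f, ← hh, ← Category.assoc, hg, Category.id_comp]
  exact ⟨g, hg, this ▸ hh⟩

end PForest

end Groupoids

/-! ### The order on the edges of a rooted tree -/

namespace RTree

variable (T : RTree)

/-- One step down, from an input edge of a node to its output edge. -/
def Step (x y : T.A) : Prop := ∃ n m, T.ins n m = x ∧ T.out n = y

/-- The edge `x` lies above the edge `y`. -/
def Above (x y : T.A) : Prop := Relation.ReflTransGen T.Step x y

theorem above_root (x : T.A) : T.Above x T.root := T.walk x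

variable {T}

theorem step_rightUnique : Relator.RightUnique T.Step := by
  rintro x y z ⟨n, m, h, rfl⟩ ⟨n', m', h', rfl⟩
  have := T.ins_inj (a₁ := ⟨n, m⟩) (a₂ := ⟨n', m'⟩) (h.trans h'.symm)
  cases this
  rfl

theorem not_step_root (x : T.A) : ¬ T.Step T.root x := by
  rintro ⟨n, m, h, -⟩
  exact (T.ins_range _).2 ⟨n, m, h⟩ rfl

theorem eq_root_of_root_above {x : T.A} (h : T.Above T.root x) : x = T.root := by
  rcases Relation.ReflTransGen.cases_head h with h | ⟨y, h, -⟩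
  · exact h.symm
  · exact (not_step_root _ h).elim

/-- There are no cycles: a cycle through an edge also passes through the next edge down, hence would
reach the root, from which no step starts. -/
theorem not_above_of_step {x y : T.A} (h : T.Step x y) : ¬ T.Above y x := by
  intro h'
  have key : ∀ z, T.Above z T.root → ¬ ∃ w, T.Step z w ∧ T.Above w z := by
    intro z hz
    induction hz using Relation.ReflTransGen.head_induction_on with
    | refl => rintro ⟨w, hw, -⟩; exact not_step_root _ hw
    | head hab _ ih =>
      rintro ⟨w, hw, hwa⟩
      obtain rfl := step_rightUnique hab hw
      rcases Relation.ReflTransGen.cases_head hwa with h | ⟨c, hc, hca⟩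
      · subst h; exact ih ⟨_, hab, .refl⟩
      · exact ih ⟨c, hc, hca.tail hab⟩
  exact key x (T.above_root x) ⟨y, h, h'⟩

/-- The edges below `x` form a chain, because steps are single-valued. Two inputs of one node are
therefore comparable, and if distinct they would give a cycle through the output of the node. -/
theorem eq_of_above_ins {x : T.A} {n : T.N} {m m' : T.M n} (h : T.Above x (T.ins n m))
    (h' : T.Above x (T.ins n m')) : m = m' := by
  have key : ∀ k k', T.Above (T.ins n k) (T.ins n k') → k = k' := by
    intro k k' hk
    rcases Relation.ReflTransGen.cases_head hk with hk | ⟨c, hc, hck⟩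
    · have := T.ins_inj (a₁ := ⟨n, k⟩) (a₂ := ⟨n, k'⟩) hk
      cases this
      rfl
    · obtain rfl := step_rightUnique hc ⟨n, k, rfl, rfl⟩
      exact (not_above_of_step ⟨n, k', rfl, rfl⟩ hck).elim
  rcases Relation.ReflTransGen.total_of_right_unique step_rightUnique h h' with h | h
  · exact key _ _ h
  · exact (key _ _ h).symm

end RTree

/-! ### Cutting a tree at its root node -/

section Structure

variable {I : Type u₁} {E : Type u₂} {B : Type u₃}
  [Groupoid.{v₁} I] [Groupoid.{v₂} E] [Groupoid.{v₃} B] {P : PolyEndo I E B}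

namespace PTree

/-- The subtree of all the edges and nodes above a given edge. -/
def above (T : PTree P) (a : T.A) : PTree P where
  A := {x // T.Above x a}
  N := {n // T.Above (T.out n) a}
  M n := T.M n.1
  finA := have := T.finA; inferInstance
  ins n m := ⟨T.ins n.1 m, Relation.ReflTransGen.head ⟨n.1, m, rfl, rfl⟩ n.2⟩
  out n := ⟨T.out n.1, n.2⟩
  root := ⟨a, .refl⟩
  out_inj n n' h := Subtype.ext (T.out_inj (congrArg Subtype.val h))
  ins_inj := by
    rintro ⟨⟨n, hn⟩, m⟩ ⟨⟨n', hn'⟩, m'⟩ h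
    have := T.ins_inj (a₁ := ⟨n, m⟩) (a₂ := ⟨n', m'⟩) (congrArg Subtype.val h)
    cases this
    rfl
  ins_range := by
    rintro ⟨x, hx⟩
    constructor
    · intro h
      rcases Relation.ReflTransGen.cases_head hx with h' | ⟨y, ⟨n, m, rfl, rfl⟩, hy⟩
      · exact (h (Subtype.ext h')).elim
      · exact ⟨⟨n, hy⟩, m, rfl⟩
    · rintro ⟨⟨n, hn⟩, m, h⟩ h'
      have h1 : T.ins n m = a := (congrArg Subtype.val h).trans (congrArg Subtype.val h')
      exact RTree.not_above_of_step ⟨n, m, h1, rfl⟩ hn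
  walk := by
    rintro ⟨x, hx⟩
    exact Relation.ReflTransGen.head_induction_on (motive := fun x hx =>
      Relation.ReflTransGen _ (⟨x, hx⟩ : {x // T.Above x a}) ⟨a, .refl⟩) hx .refl
      fun ⟨n, m, h, h'⟩ hc ih => Relation.ReflTransGen.head
        ⟨⟨n, h' ▸ hc⟩, m, Subtype.ext h, Subtype.ext h'⟩ ih
  colour x := T.colour x.1
  label n := T.label n.1
  slot n m := T.slot n.1 m
  insIso n m := T.insIso n.1 m
  midIso n m := T.midIso n.1 m
  outIso n := T.outIso n.1
  cart n := T.cart n.1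

/-- The family of trees above the inputs of a node. -/
def branches (T : PTree P) (n : T.N) : P.EvalT where
  op := T.label n
  ι := T.M n
  fin := T.finite_M n
  deco m := T.above (T.ins n m)
  slot m := T.slot n m
  midIso m := T.midIso n m
  cart := T.cart n
  insIso m := T.insIso n m

theorem eq_root_or_above_ins {T : PTree P} {n : T.N} (hn : T.out n = T.root) (x : T.A) :
    x = T.root ∨ ∃ m, T.Above x (T.ins n m) := by
  rcases Relation.ReflTransGen.cases_tail (T.above_root x) with h | ⟨y, h, n', m, rfl, h'⟩
  · exact .inl h.symm
  · obtain rfl := T.out_inj (h'.trans hn.symm)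
    exact .inr ⟨m, h⟩

/-- A tree with a root node is obtained by grafting the branches of the root node. -/
def graftBranches (T : PTree P) (n : T.N) (hn : T.out n = T.root) :
    P.graft.obj (T.branches n) ⟶ T :=
  have edge_inj : Function.Injective (fun x : Option (Σ m, {x // T.Above x (T.ins n m)}) =>
      match x with
      | none => T.root
      | some x => x.2.1) := by
    have h0 : ∀ m x, T.Above x (T.ins n m) → x ≠ T.root := by
      rintro m x h rfl
      exact (T.ins_range (T.ins n m)).2 ⟨n, m, rfl⟩ (RTree.eq_root_of_root_above h)
    rintro (_ | ⟨m, x, hx⟩) (_ | ⟨m', y, hy⟩) h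
    · rfl
    · exact (h0 _ _ hy h.symm).elim
    · exact (h0 _ _ hx h).elim
    · obtain rfl : x = y := h
      obtain rfl := RTree.eq_of_above_ins hx hy
      rfl
  { edge := fun x => match x with
      | none => T.root
      | some x => x.2.1
    node := fun x => match x with
      | none => n
      | some x => x.2.1
    inp := fun x => match x with
      | none => fun m => m
      | some _ => fun m => m
    edge_bij := by
      refine ⟨edge_inj, fun x => ?_⟩
      rcases eq_root_or_above_ins hn x with rfl | ⟨m, h⟩
      · exact ⟨none, rfl⟩
      · exact ⟨some ⟨m, x, h⟩, rfl⟩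
    node_bij := by
      constructor
      · intro x y h
        -- Nodes embed into edges by their outputs, so injectivity on nodes reduces to injectivity
        -- on edges.
        refine (P.graft.obj (T.branches n)).out_inj (edge_inj ?_)
        have h' := congrArg T.out h
        rcases x with _ | ⟨m, x, hx⟩ <;> rcases y with _ | ⟨m', y, hy⟩
        · rfl
        · exact hn.symm.trans h'
        · exact h'.trans hn
        · exact h'
      · intro x
        rcases eq_root_or_above_ins hn (T.out x) with h | ⟨m, h⟩
        · exact ⟨none, T.out_inj (hn.trans h.symm)⟩
        · exact ⟨some ⟨m, x, h⟩, rfl⟩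
    inp_bij := fun x => match x with
      | none => Function.bijective_id
      | some _ => Function.bijective_id
    edge_ins := fun x => match x with
      | none => fun _ => rfl
      | some _ => fun _ => rfl
    edge_out := fun x => match x with
      | none => hn.symm
      | some _ => rfl
    -- The root of a graft is coloured by the output of the operation itself; `T.outIso n` compares
    -- this with the original root colour.
    onEdge := fun x => match x with
      | none => Groupoid.inv (T.outIso n) ≫ eqToHom (congrArg T.colour hn)
      | some _ => 𝟙 _
    onNode := fun x => match x with
      | none => 𝟙 _
      | some _ => 𝟙 _
    onSlot := fun x => match x with
      | none => fun _ => 𝟙 _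
      | some _ => fun _ => 𝟙 _
    comm_ins := fun x => match x with
      | none => fun m => by
        change T.insIso n m ≫ P.s.map (𝟙 _) = 𝟙 _ ≫ eqToHom _ ≫ T.insIso n m
        simp
      | some x => fun m => by
        change T.insIso x.2.1 m ≫ P.s.map (𝟙 _) = 𝟙 _ ≫ eqToHom _ ≫ T.insIso x.2.1 m
        simp
    comm_mid := fun x => match x with
      | none => fun m => by
        change T.midIso n m ≫ 𝟙 _ = P.p.map (𝟙 _) ≫ T.midIso n m
        simp
      | some x => fun m => by
        change T.midIso x.2.1 m ≫ 𝟙 _ = P.p.map (𝟙 _) ≫ T.midIso x.2.1 m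
        simp
    comm_out := fun x => match x with
      | none => by
        change 𝟙 _ ≫ P.t.map (𝟙 _) =
          (Groupoid.inv (T.outIso n) ≫ eqToHom (congrArg T.colour hn)) ≫ eqToHom _ ≫ T.outIso n
        have key : ∀ {i j k : I} (h : i = j) (h' : j = i) (g : i ⟶ k) (f : k ⟶ k), f = 𝟙 k →
            𝟙 k ≫ f = (Groupoid.inv g ≫ eqToHom h) ≫ eqToHom h' ≫ g := by
          rintro i _ k rfl _ g _ rfl
          simp
        exact key _ _ _ _ (P.t.map_id _)
      | some x => by
        change T.outIso x.2.1 ≫ P.t.map (𝟙 _) = 𝟙 _ ≫ eqToHom _ ≫ T.outIso x.2.1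
        simp }

/-- A tree without a root node is trivial. -/
def trivOfNoRootNode (T : PTree P) (h : ∀ n, T.out n ≠ T.root) :
    (PTree.triv P).obj (T.colour T.root) ⟶ T :=
  have h1 : ∀ x, x = T.root := fun x => by
    rcases Relation.ReflTransGen.cases_tail (T.above_root x) with hx | ⟨y, -, n, m, -, h'⟩
    · exact hx.symm
    · exact (h n h').elim
  { edge := fun _ => T.root
    node := fun n => n.elim
    inp := fun n => n.elim
    edge_bij := ⟨fun _ _ _ => rfl, fun x => ⟨PUnit.unit, (h1 x).symm⟩⟩
    node_bij := ⟨fun n => n.elim, fun n => (h n (h1 _)).elim⟩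
    inp_bij := fun n => n.elim
    edge_ins := fun n => n.elim
    edge_out := fun n => n.elim
    onEdge := fun _ => 𝟙 _
    onNode := fun n => n.elim
    onSlot := fun n => n.elim
    comm_ins := fun n => n.elim
    comm_mid := fun n => n.elim
    comm_out := fun n => n.elim }

theorem exists_iso (T : PTree P) :
    (∃ i, Nonempty ((PTree.triv P).obj i ≅ T)) ∨ ∃ x, Nonempty (P.graft.obj x ≅ T) := by
  by_cases h : ∃ n, T.out n = T.root
  · obtain ⟨n, hn⟩ := h
    have := isIso (T.graftBranches n hn)
    exact .inr ⟨_, ⟨asIso (T.graftBranches n hn)⟩⟩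
  · push Not at h
    have := isIso (T.trivOfNoRootNode h)
    exact .inl ⟨_, ⟨asIso (T.trivOfNoRootNode h)⟩⟩

/-- A graft has a node and a trivial tree has none. -/
theorem isEmpty_triv_hom_graft (i : I) (x : P.EvalT) :
    IsEmpty ((PTree.triv P).obj i ⟶ P.graft.obj x) :=
  ⟨fun f => ((Hom.node_bij f).2 none).choose.elim⟩

theorem isEmpty_graft_hom_triv (i : I) (x : P.EvalT) :
    IsEmpty (P.graft.obj x ⟶ (PTree.triv P).obj i) :=
  ⟨fun f => (Hom.node f none).elim⟩

theorem triv_map_bijective (i j : I) :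
    Function.Bijective ((PTree.triv P).map : (i ⟶ j) → _) := by
  constructor
  · intro f g h
    exact congrFun (eq_of_heq (Hom.mk.inj h).2.2.2.1) PUnit.unit
  · intro f
    exact ⟨Hom.onEdge f PUnit.unit, Hom.ext_heq (fun _ => rfl) (fun n => n.elim) (fun n => n.elim)
      (fun _ => HEq.rfl) (fun n => n.elim) (fun n => n.elim)⟩

instance : (PTree.triv P).Full := ⟨(triv_map_bijective _ _).2⟩

instance : (PTree.triv P).Faithful := ⟨fun h => (triv_map_bijective _ _).1 h⟩

end PTree

end Structure

/-! ### Full faithfulness of grafting and the structure equivalence -/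

section Structure

variable {I : Type u₁} {E : Type u₂} {B : Type u₃}
  [Groupoid.{v₁} I] [Groupoid.{v₂} E] [Groupoid.{v₃} B] {P : PolyEndo I E B}

namespace PolyEndo

/-- The components at the new node `none` recover the permutation and the arrows in `B` and `E`;
those at `some ⟨i, _⟩` recover the morphism of the `i`-th trees. -/
theorem graft_map_injective (x y : P.EvalT) :
    Function.Injective (P.graft.map : (x ⟶ y) → _) := by
  rintro ⟨f, σ, hσ, d, o, c1, c2⟩ ⟨f', σ', hσ', d', o', c1', c2'⟩ h
  obtain rfl : σ = σ' := eq_of_heq (congr_arg_heq (fun k => PTree.Hom.inp k none) h)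
  obtain rfl : f = f' := eq_of_heq (congr_arg_heq (fun k => PTree.Hom.onNode k none) h)
  obtain rfl : o = o' := eq_of_heq (congr_arg_heq (fun k => PTree.Hom.onSlot k none) h)
  obtain rfl : d = d' := by
    funext i
    refine PTree.Hom.ext_heq (fun a => ?_) (fun n => ?_)
      (fun n m => congr_arg_heq (fun k => PTree.Hom.inp k (some ⟨i, n⟩) m) h)
      (fun a => congr_arg_heq (fun k => PTree.Hom.onEdge k (some ⟨i, a⟩)) h)
      (fun n => congr_arg_heq (fun k => PTree.Hom.onNode k (some ⟨i, n⟩)) h)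
      (fun n m => congr_arg_heq (fun k => PTree.Hom.onSlot k (some ⟨i, n⟩) m) h)
    · have h1 := congrArg (fun k => PTree.Hom.edge k (some ⟨i, a⟩)) h
      exact eq_of_heq (Sigma.mk.inj (Option.some.inj h1)).2
    · have h1 := congrArg (fun k => PTree.Hom.node k (some ⟨i, n⟩)) h
      exact eq_of_heq (Sigma.mk.inj (Option.some.inj h1)).2
  rfl

/-- A morphism between grafted trees respects the families of trees and is determined on edges
and on nodes by its restrictions to these. -/
theorem exists_of_graft_hom {x y : P.EvalT} (f : P.graft.obj x ⟶ P.graft.obj y) :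
    ∃ (σ : x.ι → y.ι) (ε : ∀ i, (x.deco i).A → (y.deco (σ i)).A)
      (ν : ∀ i, (x.deco i).N → (y.deco (σ i)).N),
      (∀ i, ε i (x.deco i).root = (y.deco (σ i)).root) ∧
      PTree.Hom.edge f = Option.map (Sigma.map σ ε) ∧
      PTree.Hom.node f = Option.map (Sigma.map σ ν) := by
  have hroot : PTree.Hom.edge f none = none := PTree.Hom.edge_root f
  have hnode : PTree.Hom.node f none = none := by
    have h : (P.graft.obj y).out (PTree.Hom.node f none) = none :=
      (PTree.Hom.edge_out f none).symm.trans hroot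
    exact (P.graft.obj y).out_inj (h.trans rfl)
  have hσ : ∀ i, ∃ j, PTree.Hom.edge f (some ⟨i, (x.deco i).root⟩) =
      some ⟨j, (y.deco j).root⟩ := by
    intro i
    have key : ∀ (n : (P.graft.obj y).N) (m : (P.graft.obj y).M n), n = none →
        ∃ j, (P.graft.obj y).ins n m = some ⟨j, (y.deco j).root⟩ := by
      rintro _ m rfl
      exact ⟨m, rfl⟩
    obtain ⟨j, hj⟩ := key _ (PTree.Hom.inp f none i) hnode
    exact ⟨j, (PTree.Hom.edge_ins f none i).trans hj⟩
  choose σ hσ using hσ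
  have node_some : ∀ i n, ∃ z, PTree.Hom.node f (some ⟨i, n⟩) = some z := by
    intro i n
    rcases h : PTree.Hom.node f (some ⟨i, n⟩) with _ | z
    · exact absurd ((PTree.Hom.node_bij f).1 (h.trans hnode.symm)) (by simp)
    · exact ⟨z, rfl⟩
  -- Induction upwards from the root of the `i`-th tree. Consecutive edges are joined by a node,
  -- whose image is not the root node and so lies within a single tree of the target.
  have hε : ∀ i a, ∃ a', PTree.Hom.edge f (some ⟨i, a⟩) = some ⟨σ i, a'⟩ := by
    intro i a
    induction (x.deco i).walk a using Relation.ReflTransGen.head_induction_on with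
    | refl => exact ⟨_, hσ i⟩
    | head h _ ih =>
      obtain ⟨n, m, rfl, rfl⟩ := h
      obtain ⟨b, hb⟩ := ih
      obtain ⟨⟨k, n'⟩, hz⟩ := node_some i n
      have h1 : (P.graft.obj y).out (PTree.Hom.node f (some ⟨i, n⟩)) = some ⟨σ i, b⟩ :=
        (PTree.Hom.edge_out f (some ⟨i, n⟩)).symm.trans hb
      rw [hz] at h1
      obtain rfl : k = σ i := congrArg Sigma.fst (Option.some.inj h1)
      have key : ∀ (z : (P.graft.obj y).N) (m : (P.graft.obj y).M z), z = some ⟨σ i, n'⟩ →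
          ∃ a', (P.graft.obj y).ins z m = some ⟨σ i, a'⟩ := by
        rintro _ m rfl
        exact ⟨_, rfl⟩
      obtain ⟨a', ha'⟩ := key _ (PTree.Hom.inp f (some ⟨i, n⟩) m) hz
      exact ⟨a', (PTree.Hom.edge_ins f (some ⟨i, n⟩) m).trans ha'⟩
  have hν : ∀ i n, ∃ n', PTree.Hom.node f (some ⟨i, n⟩) = some ⟨σ i, n'⟩ := by
    intro i n
    obtain ⟨⟨k, n'⟩, hz⟩ := node_some i n
    obtain ⟨b, hb⟩ := hε i ((x.deco i).out n)
    have h1 : (P.graft.obj y).out (PTree.Hom.node f (some ⟨i, n⟩)) = some ⟨σ i, b⟩ :=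
      (PTree.Hom.edge_out f (some ⟨i, n⟩)).symm.trans hb
    rw [hz] at h1
    obtain rfl : k = σ i := congrArg Sigma.fst (Option.some.inj h1)
    exact ⟨n', hz⟩
  choose ε hε using hε
  choose ν hν using hν
  refine ⟨σ, ε, ν, fun i => ?_, funext ?_, funext ?_⟩
  · have := (hε i _).symm.trans (hσ i)
    exact eq_of_heq (Sigma.mk.inj (Option.some.inj this)).2
  · rintro (_ | ⟨i, a⟩)
    · exact hroot
    · exact hε i a
  · rintro (_ | ⟨i, n⟩)
    · exact hnode
    · exact hν i n

theorem bijective_of_optionSigma {ι κ : Type} {A : ι → Type} {A' : κ → Type} {σ : ι → κ}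
    (hσ : Function.Injective σ) (f : ∀ i, A i → A' (σ i))
    (h : Function.Bijective (Option.map (Sigma.map σ f))) (i : ι) :
    Function.Bijective (f i) := by
  constructor
  · intro a b hab
    have := @h.1 (some ⟨i, a⟩) (some ⟨i, b⟩) (congrArg (fun a => some (Sigma.mk (σ i) a)) hab)
    exact eq_of_heq (Sigma.mk.inj (Option.some.inj this)).2
  · intro b
    obtain ⟨_ | ⟨j, a⟩, hz⟩ := h.2 (some ⟨σ i, b⟩)
    · cases hz
    · obtain ⟨h1, h2⟩ := Sigma.mk.inj (Option.some.inj hz)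
      obtain rfl := hσ h1
      exact ⟨a, eq_of_heq h2⟩

theorem graft_map_surjective (x y : P.EvalT) :
    Function.Surjective (P.graft.map : (x ⟶ y) → _) := by
  intro f
  obtain ⟨σ, ε, ν, hroot, hε, hν⟩ := exists_of_graft_hom f
  obtain ⟨e, n, inp, he, hn, hi, h1, h2, oe, on, os, c1, c2, c3⟩ := f
  dsimp only at hε hν
  subst hε hν
  have hσ : inp none = σ := by
    funext i
    exact (congrArg Sigma.fst (Option.some.inj (h1 none i))).symm
  have hσb : Function.Bijective σ := hσ ▸ hi none
  -- The slot arrows of `f` end at `y.slot (inp none i)`, and must be transported along `inp none =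
  -- σ`.
  obtain ⟨so, hso, cm, ci⟩ : ∃ so : ∀ i, x.slot i ⟶ y.slot (σ i), (∀ i, so i ≍ os none i) ∧
      (∀ i, x.midIso i ≫ on none = P.p.map (so i) ≫ y.midIso (σ i)) ∧
      (∀ i, x.insIso i ≫ P.s.map (so i) = oe (some ⟨i, (x.deco i).root⟩) ≫
        eqToHom (congrArg (y.deco (σ i)).colour (hroot i)) ≫ y.insIso (σ i)) := by
    have key : ∀ (τ : x.ι → y.ι) (hτ : τ = σ) (o : ∀ i, x.slot i ⟶ y.slot (τ i))
        (_ : ∀ i, x.midIso i ≫ on none = P.p.map (o i) ≫ y.midIso (τ i))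
        (_ : ∀ i (h : (y.deco (σ i)).colour (ε i (x.deco i).root) =
          (y.deco (τ i)).colour (y.deco (τ i)).root),
          x.insIso i ≫ P.s.map (o i) = oe (some ⟨i, (x.deco i).root⟩) ≫
            eqToHom h ≫ y.insIso (τ i)),
        ∃ so : ∀ i, x.slot i ⟶ y.slot (σ i), (∀ i, so i ≍ o i) ∧
          (∀ i, x.midIso i ≫ on none = P.p.map (so i) ≫ y.midIso (σ i)) ∧
          (∀ i, x.insIso i ≫ P.s.map (so i) = oe (some ⟨i, (x.deco i).root⟩) ≫
            eqToHom (congrArg (y.deco (σ i)).colour (hroot i)) ≫ y.insIso (σ i)) := by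
      rintro τ rfl o h h'
      exact ⟨o, fun _ => HEq.rfl, h, fun i => h' i _⟩
    exact key (inp none) hσ (os none) (c2 none) (fun i _ => c1 none i)
  let d : ∀ i, PTree.Hom (x.deco i) (y.deco (σ i)) := fun i =>
    { edge := ε i
      node := ν i
      inp := fun n => inp (some ⟨i, n⟩)
      edge_bij := bijective_of_optionSigma (A := fun i => (x.deco i).A)
        (A' := fun j => (y.deco j).A) hσb.1 ε he i
      node_bij := bijective_of_optionSigma (A := fun i => (x.deco i).N)
        (A' := fun j => (y.deco j).N) hσb.1 ν hn i
      inp_bij := fun n => hi (some ⟨i, n⟩)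
      edge_ins := fun n m =>
        eq_of_heq (Sigma.mk.inj (Option.some.inj (h1 (some ⟨i, n⟩) m))).2
      edge_out := fun n => eq_of_heq (Sigma.mk.inj (Option.some.inj (h2 (some ⟨i, n⟩)))).2
      onEdge := fun a => oe (some ⟨i, a⟩)
      onNode := fun n => on (some ⟨i, n⟩)
      onSlot := fun n m => os (some ⟨i, n⟩) m
      comm_ins := fun n m => c1 (some ⟨i, n⟩) m
      comm_mid := fun n m => c2 (some ⟨i, n⟩) m
      comm_out := fun n => c3 (some ⟨i, n⟩) }
  refine ⟨⟨on none, σ, hσb, d, so, cm, fun i => (ci i).trans (Category.assoc _ _ _).symm⟩, ?_⟩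
  refine PTree.Hom.ext_heq (fun _ => rfl) (fun _ => rfl) ?_ ?_ (by rintro (_ | _) <;> rfl) ?_
  · rintro (_ | n) m
    · exact heq_of_eq (congrFun hσ m).symm
    · rfl
  · rintro (_ | a)
    -- Both grafts have an identity as `outIso` at the new node, so the output square there forces
    -- the arrow on the root colour.
    · have h : (𝟙 _ ≫ P.t.map (on none) : P.t.obj x.op ⟶ P.t.obj y.op) =
        oe none ≫ 𝟙 _ ≫ 𝟙 _ := c3 none
      simp only [Category.id_comp, Category.comp_id] at h
      exact heq_of_eq h
    · rfl
  · rintro (_ | n) m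
    · exact hso m
    · rfl

instance : P.graft.Full := ⟨graft_map_surjective _ _⟩

instance : P.graft.Faithful := ⟨fun h => graft_map_injective _ _ h⟩

instance : P.structureMap.Full where
  map_surjective := by
    rintro (i | x) (j | y) f
    · obtain ⟨g, hg⟩ := (PTree.triv P).map_surjective f
      exact ⟨(Sum.inl_ _ _).map g, hg⟩
    · exact ((PTree.isEmpty_triv_hom_graft i y).false f).elim
    · exact ((PTree.isEmpty_graft_hom_triv j x).false f).elim
    · obtain ⟨g, hg⟩ := P.graft.map_surjective f
      exact ⟨(Sum.inr_ _ _).map g, hg⟩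

instance : P.structureMap.Faithful where
  map_injective := by
    rintro (i | x) (j | y) f g h
    · obtain ⟨f⟩ := f
      obtain ⟨g⟩ := g
      exact congrArg _ ((PTree.triv P).map_injective h)
    · exact (hom_inl_inr_false _ _ f).elim
    · exact (hom_inr_inl_false _ _ f).elim
    · obtain ⟨f⟩ := f
      obtain ⟨g⟩ := g
      exact congrArg _ (P.graft.map_injective h)

instance : P.structureMap.EssSurj where
  mem_essImage T := by
    rcases T.exists_iso with ⟨i, ⟨h⟩⟩ | ⟨x, ⟨h⟩⟩
    · exact ⟨.inl i, ⟨h⟩⟩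
    · exact ⟨.inr x, ⟨h⟩⟩

variable (P) in
theorem structureMap_isEquivalence : P.structureMap.IsEquivalence := { }

end PolyEndo

end Structure

/-! ### Homotopy cardinality of discrete homotopy fibres -/

section HomotopyCardinality

/-- Trivial automorphism groups make every component count 1. Finiteness of `S` is not needed: for
infinite `S` both sides take the default value 0. -/
theorem hcard_eq_natCard {C S : Type*} [Category C] (φ : C → S) (hφ : Function.Surjective φ)
    (hiso : ∀ x y, φ x = φ y ↔ Nonempty (x ≅ y)) (haut : ∀ x : C, Subsingleton (Aut x)) :
    hcard C = Nat.card S := by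
  have h1 : ∀ x : Pi0 C, ((Nat.card (Aut x.out) : ℚ))⁻¹ = 1 := fun x => by
    have := haut x.out
    simp
  have h2 : Function.Bijective (Quotient.lift φ fun x y h => (hiso x y).2 h : Pi0 C → S) := by
    constructor
    · rintro ⟨x⟩ ⟨y⟩ h
      exact Quotient.sound ((hiso x y).1 h)
    · intro s
      obtain ⟨x, rfl⟩ := hφ s
      exact ⟨Quotient.mk _ x, rfl⟩
  rw [hcard, finsum_congr h1, ← Nat.card_eq_of_bijective _ h2, ← Set.ncard_univ]
  rw [← finsum_one, finsum_mem_univ, ← Nat.coe_castAddMonoidHom, AddMonoidHom.map_finsum_of_injective]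
  · simp
  · exact Nat.cast_injective

theorem hcard_of_isEmpty (C : Type*) [Category C] [IsEmpty C] : hcard C = 0 := by
  have : IsEmpty (Pi0 C) := ⟨fun x => isEmptyElim x.out⟩
  exact finsum_of_isEmpty _

/-- The set of arrows is a torsor under `Aut x` when it is non-empty. -/
theorem card_hom_out {C : Type*} [Category C] (hC : ∀ {x y : C} (f : x ⟶ y), IsIso f)
    (x : C) (c : Pi0 C) [Decidable (c = Quotient.mk _ x)] :
    Nat.card (x ⟶ c.out) = if c = Quotient.mk _ x then Nat.card (Aut x) else 0 := by
  split_ifs with h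
  · obtain ⟨e⟩ : Nonempty (x ≅ c.out) :=
      Quotient.exact (s := isIsomorphicSetoid C) (h.symm.trans c.out_eq.symm)
    refine Nat.card_congr
      { toFun := fun f => (have := hC f; asIso f ≪≫ e.symm : x ≅ x)
        invFun := fun f => Iso.hom f ≫ e.hom
        left_inv := fun f => by simp
        right_inv := fun f => ?_ }
    apply Iso.ext
    simp
  · have : IsEmpty (x ⟶ c.out) := ⟨fun f => h <| by
      have := hC f
      rw [← c.out_eq]
      exact (Quotient.sound (s := isIsomorphicSetoid C) ⟨asIso f⟩).symm⟩
    simp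

theorem card_aut_congr {C : Type*} [Category C] {x y : C} (e : x ≅ y) :
    Nat.card (Aut x) = Nat.card (Aut y) := Nat.card_congr (Aut.autMulEquivOfIso e).toEquiv

theorem card_aut_eq {C : Type*} [Category C] (hC : ∀ {x y : C} (f : x ⟶ y), IsIso f) (x : C) :
    Nat.card (Aut x) = Nat.card (x ⟶ x) :=
  Nat.card_congr
    { toFun := Iso.hom
      invFun := fun f => have := hC f; asIso f
      left_inv := fun _ => Iso.ext rfl
      right_inv := fun _ => rfl }

/-- A groupoid of objects of `M` equipped with a map to `t` and an element of a presheaf `X`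
is discrete, represented by the elements of `X m`, if `R.obj m` is isomorphic to `t`. -/
theorem hcard_eq_card_presheaf {C M T : Type*} [Category C] [Category M] [Category T]
    (hT : ∀ {x y : T} (f : x ⟶ y), IsIso f) (Q : C ⥤ M) [Q.Faithful] (R : M ⥤ T) [R.Full]
    [R.Faithful] {t : T} {m : M} (v : R.obj m ⟶ t)
    (X : M → Type*) (ρ : ∀ {x y : M}, (x ⟶ y) → X y → X x) (ρ_id : ∀ x u, ρ (𝟙 x) u = u)
    (ρ_comp : ∀ {x y z : M} (f : x ⟶ y) (g : y ⟶ z) u, ρ (f ≫ g) u = ρ f (ρ g u))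
    (r : ∀ c, R.obj (Q.obj c) ⟶ t) (s : ∀ c, X (Q.obj c))
    (r_nat : ∀ {c d} (g : c ⟶ d), R.map (Q.map g) ≫ r d = r c)
    (s_nat : ∀ {c d} (g : c ⟶ d), ρ (Q.map g) (s d) = s c)
    (lift : ∀ {c d} (g : Q.obj c ⟶ Q.obj d), R.map g ≫ r d = r c → ρ g (s d) = s c →
      ∃ g' : c ⟶ d, Q.map g' = g)
    (surj : ∀ u : X m, ∃ c, ∃ h : m ⟶ Q.obj c, R.map h ≫ r c = v ∧ ρ h (s c) = u) :
    hcard C = Nat.card (X m) := by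
  have hM : ∀ {x y : M} (g : x ⟶ y), IsIso g := fun g =>
    have := hT (R.map g)
    isIso_of_reflects_iso g R
  have hv : ∀ c, ∃ a : m ⟶ Q.obj c, R.map a ≫ r c = v := fun c => by
    have := hT (r c)
    exact ⟨R.preimage (v ≫ inv (r c)), by simp⟩
  have cancel : ∀ {x} {c} (f g : x ⟶ Q.obj c), R.map f ≫ r c = R.map g ≫ r c → f = g := by
    intro x c f g h
    have := hT (r c)
    exact R.map_injective ((cancel_mono _).1 h)
  -- The arrow `a c` is the only one over `v`, so `c` is classified by its element `s c` pulled back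
  -- along `a c` to `X m`.
  choose a ha using hv
  refine hcard_eq_natCard (fun c => ρ (a c) (s c)) (fun u => ?_) (fun c d => ⟨fun h => ?_, ?_⟩)
    (fun c => ⟨fun i j => ?_⟩)
  · obtain ⟨c, h, h1, rfl⟩ := surj u
    exact ⟨c, congrArg (ρ · (s c)) (cancel _ _ ((ha c).trans h1.symm))⟩
  · have := hM (a c)
    have := hM (a d)
    have transport : ∀ {c d} [IsIso (a c)], ρ (a c) (s c) = ρ (a d) (s d) →
        ∃ g' : c ⟶ d, Q.map g' = inv (a c) ≫ a d := by
      intro c d _ h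
      refine lift _ ?_ ?_
      · rw [R.map_comp, Category.assoc, ha, ← ha c, ← Category.assoc, ← R.map_comp]
        simp
      · rw [ρ_comp, ← h, ← ρ_comp, IsIso.inv_hom_id, ρ_id]
    obtain ⟨g, hg⟩ := transport h
    obtain ⟨g', hg'⟩ := transport h.symm
    exact ⟨⟨g, g', Q.map_injective (by simp [hg, hg']), Q.map_injective (by simp [hg, hg'])⟩⟩
  · rintro ⟨i⟩
    have : a c ≫ Q.map i.hom = a d := cancel _ _ (by rw [R.map_comp, Category.assoc, r_nat, ha, ha])
    change ρ (a c) (s c) = ρ (a d) (s d)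
    rw [← this, ρ_comp, s_nat]
  · exact Iso.ext (Q.map_injective (cancel _ _ ((r_nat i.hom).trans (r_nat j.hom).symm)))

variable {M F T B : Type*} [Category M] [Category F] [Category T] [Category B]

/-- The homotopy fibre of `(L, R)`, with `R` fully faithful, is discrete. -/
theorem hcard_fiber_prod (hT : ∀ {x y : T} (f : x ⟶ y), IsIso f) (L : M ⥤ F) (R : M ⥤ T)
    [R.Full] [R.Faithful] (f : F) {t : T} {m : M} (v : R.obj m ⟶ t) :
    hcard (CostructuredArrow (L.prod' R) (f, t)) = Nat.card (L.obj m ⟶ f) :=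
  hcard_eq_card_presheaf hT (CostructuredArrow.proj (L.prod' R) (f, t)) R v
    (fun x => L.obj x ⟶ f) (fun g u => L.map g ≫ u) (fun _ _ => by simp)
    (fun _ _ _ => by simp) (fun c => c.hom.2) (fun c => c.hom.1)
    (fun g => congrArg Prod.snd (CostructuredArrow.w g))
    (fun g => congrArg Prod.fst (CostructuredArrow.w g))
    (fun g h h' => ⟨CostructuredArrow.homMk g (Prod.ext h' h), rfl⟩)
    (fun u => ⟨CostructuredArrow.mk (Y := m) (S := L.prod' R) (T := (f, t)) (Prod.mk u v), 𝟙 m,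
      (congrArg (· ≫ v) (R.map_id m)).trans (Category.id_comp v),
      (congrArg (· ≫ u) (L.map_id m)).trans (Category.id_comp u)⟩)

/-- The homotopy fibre of the restriction of `(L, R)`, with `R` fully faithful, to a homotopy fibre
of a further functor is discrete. -/
theorem hcard_fiber_prod_fiber (hT : ∀ {x y : T} (f : x ⟶ y), IsIso f) (L : M ⥤ F) (R : M ⥤ T)
    (O : M ⥤ B) [R.Full] [R.Faithful] (b : B) (f : F) {t : T} {m : M} (v : R.obj m ⟶ t) :
    hcard (CostructuredArrow
      ((CostructuredArrow.proj O b ⋙ L).prod' (CostructuredArrow.proj O b ⋙ R)) (f, t)) =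
      Nat.card (L.obj m ⟶ f) * Nat.card (O.obj m ⟶ b) := by
  rw [← Nat.cast_mul, ← Nat.card_prod]
  exact hcard_eq_card_presheaf hT (CostructuredArrow.proj
    ((CostructuredArrow.proj O b ⋙ L).prod' (CostructuredArrow.proj O b ⋙ R)) (f, t) ⋙
      CostructuredArrow.proj O b) R v
    (fun x => (L.obj x ⟶ f) × (O.obj x ⟶ b)) (fun g u => (L.map g ≫ u.1, O.map g ≫ u.2))
    (fun _ _ => by simp) (fun _ _ _ => by simp) (fun c => c.hom.2) (fun c => (c.hom.1, c.left.hom))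
    (fun g => congrArg Prod.snd (CostructuredArrow.w g))
    (fun g => Prod.ext (congrArg Prod.fst (CostructuredArrow.w g) :)
      (CostructuredArrow.w g.left))
    (fun g h h' => ⟨CostructuredArrow.homMk (CostructuredArrow.homMk g (Prod.mk.inj h').2)
      (Prod.ext (Prod.mk.inj h').1 h), rfl⟩)
    (fun u => ⟨CostructuredArrow.mk (Y := CostructuredArrow.mk u.2)
      (S := (CostructuredArrow.proj O b ⋙ L).prod' (CostructuredArrow.proj O b ⋙ R))
      (T := (f, t)) (Prod.mk u.1 v), 𝟙 m,
      (congrArg (· ≫ v) (R.map_id m)).trans (Category.id_comp v),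
      Prod.ext ((congrArg (· ≫ u.1) (L.map_id m)).trans (Category.id_comp u.1))
        ((congrArg (· ≫ u.2) (O.map_id m)).trans (Category.id_comp u.2))⟩)

end HomotopyCardinality

/-! ### Powers and exponential of a linear power series -/

section LinearSeries

/-- The weight of a monomial in the exponential of a linear series. -/
noncomputable def expWeight {σ : Type*} (g : σ → ℚ) (e : σ →₀ ℕ) : ℚ :=
  e.prod fun T k => g T ^ k / (k.factorial : ℚ)

/-- Only the factor of `T` changes, and there `g · g^(k-1) / (k-1)! = k · g^k / k!`. -/
theorem mul_expWeight_sub_single {σ : Type*} (g : σ → ℚ) {e : σ →₀ ℕ} {T : σ} (h : e T ≠ 0) :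
    g T * expWeight g (e - Finsupp.single T 1) = e T * expWeight g e := by
  classical
  have h0 : ∀ T, g T ^ 0 / (Nat.factorial 0 : ℚ) = 1 := by simp
  have he : (e - Finsupp.single T 1).erase T = e.erase T := by
    ext T'
    by_cases hT : T' = T
    · simp [hT]
    · simp [Finsupp.erase_ne hT, Ne.symm hT]
  obtain ⟨k, hk⟩ := Nat.exists_eq_succ_of_ne_zero h
  rw [expWeight, expWeight, ← Finsupp.mul_prod_erase' _ T _ h0,
    ← Finsupp.mul_prod_erase' e T _ h0, he]
  simp only [Finsupp.coe_tsub, Pi.sub_apply, Finsupp.single_eq_same, hk, Nat.succ_sub_one,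
    Nat.factorial_succ, Nat.succ_eq_add_one]
  push_cast
  have h1 : (k.factorial : ℚ) ≠ 0 := by positivity
  have h2 : (k + 1 : ℚ) ≠ 0 := by positivity
  field_simp
  ring

variable {σ : Type*} {g : σ → ℚ} {G : MvPowerSeries σ ℚ}

/-- The multinomial theorem in infinitely many variables. In the induction the extra factor `G`
removes one variable `T` from `e`, with multiplicity `e T`; these multiplicities sum to `n + 1`,
which turns `n!` into `(n + 1)!`. -/
theorem coeff_linear_pow (h1 : ∀ T, MvPowerSeries.coeff (Finsupp.single T 1) G = g T)
    (h0 : ∀ d, (∀ T, d ≠ Finsupp.single T 1) → MvPowerSeries.coeff d G = 0) (n : ℕ)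
    (e : σ →₀ ℕ) :
    MvPowerSeries.coeff e (G ^ n) = if e.degree = n then n.factorial * expWeight g e else 0 := by
  classical
  induction n generalizing e with
  | zero =>
    rw [pow_zero, MvPowerSeries.coeff_one]
    simp only [Finsupp.degree_eq_zero_iff]
    split_ifs with h
    · simp [h, expWeight]
    · rfl
  | succ n ih =>
    have key : MvPowerSeries.coeff e (G ^ (n + 1)) =
        ∑ T ∈ e.support, g T * MvPowerSeries.coeff (e - Finsupp.single T 1) (G ^ n) := by
      rw [pow_succ', MvPowerSeries.coeff_mul]
      symm
      refine Finset.sum_of_injOn (fun T => (Finsupp.single T 1, e - Finsupp.single T 1)) ?_ ?_ ?_ ?_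
      · intro T _ T' _ h
        exact (Finsupp.single_left_inj one_ne_zero).1 (congrArg Prod.fst h)
      · intro T hT
        rw [Finset.mem_coe, Finset.HasAntidiagonal.mem_antidiagonal]
        refine add_tsub_cancel_of_le ?_
        rw [Finsupp.single_le_iff]
        exact Nat.one_le_iff_ne_zero.2 (Finsupp.mem_support_iff.1 hT)
      · rintro ⟨a, b⟩ hab hne
        rw [Finset.HasAntidiagonal.mem_antidiagonal] at hab
        rw [h0, zero_mul]
        rintro T rfl
        refine hne ⟨T, ?_, ?_⟩
        · simp [← hab]
        · simp [← hab]
      · intro T _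
        rw [h1]
    rw [key]
    simp only [ih]
    have hdeg : ∀ T ∈ e.support, (e - Finsupp.single T 1).degree + 1 = e.degree := by
      intro T hT
      have : e - Finsupp.single T 1 + Finsupp.single T 1 = e := by
        refine tsub_add_cancel_of_le ?_
        rw [Finsupp.single_le_iff]
        exact Nat.one_le_iff_ne_zero.2 (Finsupp.mem_support_iff.1 hT)
      conv_rhs => rw [← this]
      simp
    split_ifs with h
    · have : ∀ T ∈ e.support, (g T * if (e - Finsupp.single T 1).degree = n then
          (n.factorial : ℚ) * expWeight g (e - Finsupp.single T 1) else 0) =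
          e T * (n.factorial * expWeight g e) := by
        intro T hT
        rw [if_pos (by have := hdeg T hT; omega), mul_left_comm,
          mul_expWeight_sub_single g (Finsupp.mem_support_iff.1 hT)]
        ring
      rw [Finset.sum_congr rfl this, ← Finset.sum_mul, ← Nat.cast_sum, ← Finsupp.degree_apply, h,
        Nat.factorial_succ]
      push_cast
      ring
    · refine Finset.sum_eq_zero fun T hT => ?_
      rw [if_neg (by have := hdeg T hT; omega), mul_zero]

theorem coeff_exp_linear (h1 : ∀ T, MvPowerSeries.coeff (Finsupp.single T 1) G = g T)
    (h0 : ∀ d, (∀ T, d ≠ Finsupp.single T 1) → MvPowerSeries.coeff d G = 0) (e : σ →₀ ℕ) :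
    MvPowerSeries.coeff e (PowerSeries.subst G (PowerSeries.exp ℚ)) = expWeight g e := by
  have hG : PowerSeries.HasSubst G := by
    refine PowerSeries.HasSubst.of_constantCoeff_zero ?_
    rw [← MvPowerSeries.coeff_zero_eq_constantCoeff_apply]
    exact h0 0 fun T h => by simpa using (congrArg (· T) h)
  -- Powers of a linear series are homogeneous, so only the exponent `e.degree` contributes, and its
  -- `n!` cancels the coefficient of `exp`.
  rw [PowerSeries.coeff_subst hG, finsum_eq_single _ e.degree]
  · rw [coeff_linear_pow h1 h0, if_pos rfl, PowerSeries.coeff_exp]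
    have : (e.degree.factorial : ℚ) ≠ 0 := by positivity
    simp [this]
  · intro n hn
    rw [coeff_linear_pow h1 h0, if_neg (Ne.symm hn), smul_zero]

end LinearSeries

/-! ### Monomials and symmetry factors of forests -/

section Forests

variable {I : Type u₁} {E : Type u₂} {B : Type u₃}
  [Groupoid.{v₁} I] [Groupoid.{v₂} E] [Groupoid.{v₃} B] {P : PolyEndo I E B}

namespace PForest

theorem monomial_eq_of_iso {F G : PForest P} (e : F ≅ G) : F.monomial = G.monomial := by
  rw [monomial, monomial]
  refine finsum_eq_of_bijective (Hom.perm e.hom) (Hom.perm_bij e.hom) fun i => ?_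
  have := PTree.isIso (Hom.iso e.hom i)
  rw [Quotient.sound (s := isIsomorphicSetoid (PTree P)) ⟨asIso (Hom.iso e.hom i)⟩]

theorem degree_monomial (F : PForest P) : F.monomial.degree = Nat.card F.ι := by
  have := F.fin
  have := Fintype.ofFinite F.ι
  rw [monomial, finsum_eq_sum_of_fintype, map_sum]
  simp

theorem monomial_apply (F : PForest P) [Fintype F.ι] [DecidableEq (Pi0 (PTree P))]
    (T : Pi0 (PTree P)) :
    F.monomial T = Fintype.card {i : F.ι // (Quotient.mk _ (F.tree i) : Pi0 (PTree P)) = T} := by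
  rw [monomial, finsum_eq_sum_of_fintype, Finsupp.finsetSum_apply, Fintype.card_subtype,
    Finset.card_filter]
  exact Finset.sum_congr rfl fun i _ => Finsupp.single_apply

/-- The automorphism group is a product of wreath products: a permutation preserving the classes of
the trees, together with an isomorphism from each tree to its image. -/
theorem card_aut (F : PForest P) (hT : ∀ S T : PTree P, Finite (S ⟶ T)) :
    (Nat.card (Aut F) : ℚ)⁻¹ =
      expWeight (fun T : Pi0 (PTree P) => (Nat.card (Aut T.out) : ℚ)⁻¹) F.monomial := by
  classical
  have := F.fin
  have := Fintype.ofFinite F.ι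
  let c : F.ι → Pi0 (PTree P) := fun i => Quotient.mk _ (F.tree i)
  let a : Pi0 (PTree P) → ℕ := fun T => Nat.card (Aut T.out)
  have hc : ∀ {i j} (_ : F.tree i ⟶ F.tree j), c j = c i := fun f =>
    have := PTree.isIso f
    (Quotient.sound (s := isIsomorphicSetoid (PTree P)) ⟨asIso f⟩).symm
  have hcard : ∀ i j, c j = c i → Nat.card (F.tree i ⟶ F.tree j) = a (c i) := by
    intro i j h
    obtain ⟨e⟩ : Nonempty (F.tree i ≅ (c i).out) :=
      Quotient.exact (s := isIsomorphicSetoid (PTree P)) (c i).out_eq.symm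
    obtain ⟨e'⟩ : Nonempty (F.tree j ≅ F.tree i) :=
      Quotient.exact (s := isIsomorphicSetoid (PTree P)) h
    rw [Nat.card_congr (Iso.homCongr e (e' ≪≫ e)), ← card_aut_eq PTree.isIso]
  have h1 : Nat.card (Aut F) = (∏ T ∈ Finset.univ.image c, (F.monomial T).factorial) *
      ∏ i, a (c i) := by
    rw [card_aut_eq isIso]
    let φ : (F ⟶ F) ≃ Σ s : {s : Equiv.Perm F.ι // c ∘ s = c}, ∀ i, F.tree i ⟶ F.tree (s.1 i) :=
      { toFun := fun f => ⟨⟨Equiv.ofBijective _ (Hom.perm_bij f),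
          funext fun i => hc (Hom.iso f i)⟩, fun i => Hom.iso f i⟩
        invFun := fun s => ⟨s.1.1, s.1.1.bijective, s.2⟩
        left_inv := fun f => rfl
        right_inv := fun ⟨⟨s, hs⟩, f⟩ => by
          have : Equiv.ofBijective _ s.bijective = s := Equiv.ext fun _ => rfl
          exact Sigma.ext (Subtype.ext this) HEq.rfl }
    rw [Nat.card_congr φ, Nat.card_sigma]
    have : ∀ s : {s : Equiv.Perm F.ι // c ∘ s = c},
        Nat.card (∀ i, F.tree i ⟶ F.tree (s.1 i)) = ∏ i, a (c i) := fun s => by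
      rw [Nat.card_pi]
      exact Finset.prod_congr rfl fun i _ => hcard _ _ (congrFun s.2 i)
    rw [Finset.sum_congr rfl fun s _ => this s, Finset.sum_const, Finset.card_univ,
      DomMulAct.stabilizer_card', smul_eq_mul]
    simp only [monomial_apply, c]
  have hsupp : F.monomial.support = Finset.univ.image c := by
    ext T
    rw [Finsupp.mem_support_iff, monomial_apply, ← Nat.pos_iff_ne_zero, Fintype.card_pos_iff]
    simp [c]
  rw [h1, expWeight, Finsupp.prod, hsupp, Finset.prod_comp a c]
  push_cast
  rw [← Finset.prod_mul_distrib, ← Finset.prod_inv_distrib]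
  refine Finset.prod_congr rfl fun T _ => ?_
  rw [monomial_apply, ← Fintype.card_subtype]
  simp only [a, c, div_eq_mul_inv, mul_inv, inv_pow]
  rw [mul_comm]

end PForest
end Forests

/-! ### Sums over isomorphism classes -/

theorem Pi0.mk_eq_mk_iff {C : Type*} [Category C] {x y : C} :
    (Quotient.mk _ x : Pi0 C) = Quotient.mk _ y ↔ Nonempty (x ≅ y) :=
  Quotient.eq (r := isIsomorphicSetoid C)

theorem Pi0.nonempty_mk_out_iso {C : Type*} [Category C] (x : C) :
    Nonempty ((Quotient.mk _ x : Pi0 C).out ≅ x) :=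
  Pi0.mk_eq_mk_iff.1 (Quotient.out_eq _)

theorem Pi0.card_congr {C D : Type*} [Category C] [Category D] (e : C ≌ D) :
    Nat.card (Pi0 C) = Nat.card (Pi0 D) := by
  refine Nat.card_eq_of_bijective (Quotient.map e.functor.obj
    fun _ _ ⟨i⟩ => ⟨e.functor.mapIso i⟩) ⟨?_, ?_⟩
  · rintro ⟨x⟩ ⟨y⟩ h
    obtain ⟨i⟩ := Pi0.mk_eq_mk_iff.1 h
    exact Pi0.mk_eq_mk_iff.2 ⟨e.functor.preimageIso i⟩
  · rintro ⟨y⟩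
    exact ⟨Quotient.mk _ (e.inverse.obj y), Pi0.mk_eq_mk_iff.2 ⟨e.counitIso.app y⟩⟩

/-- The weights `|Hom(x, c)| / |Aut c|` form the delta function at the class of `x`. This is what
collapses the homotopy sums over `B`. -/
theorem finsum_inv_card_aut_mul_card_hom {C : Type*} [Category C]
    (hC : ∀ {x y : C} (f : x ⟶ y), IsIso f) (hfin : ∀ x : C, Finite (Aut x)) (x : C)
    (k : Pi0 C → ℚ) :
    ∑ᶠ c : Pi0 C, (Nat.card (Aut c.out) : ℚ)⁻¹ * (k c * Nat.card (x ⟶ c.out)) =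
      k (Quotient.mk _ x) := by
  classical
  rw [finsum_eq_single _ (Quotient.mk _ x)]
  · obtain ⟨e⟩ := Pi0.nonempty_mk_out_iso x
    have := hfin x
    have h : (Nat.card (Aut x) : ℚ) ≠ 0 := Nat.cast_ne_zero.2 Nat.card_pos.ne'
    rw [card_hom_out hC, if_pos rfl, card_aut_congr e]
    field_simp
  · intro c hc
    rw [card_hom_out hC, if_neg hc]
    simp

/-! ### Coefficients of the operators and the Dyson–Schwinger equation -/

section

variable {I : Type u₁} {E : Type u₂} {B : Type u₃}
  [Groupoid.{v₁} I] [Groupoid.{v₂} E] [Groupoid.{v₃} B] {P : PolyEndo I E B}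

namespace PolyEndo

theorem arity_congr {b b' : B} (e : b ≅ b') : P.arity b = P.arity b' :=
  Pi0.card_congr (CostructuredArrow.mapIso e)

theorem Eval.card_ι {X : Type*} [Category X] {c : X ⥤ I} (x : P.Eval c) :
    Nat.card x.ι = P.arity x.op := Nat.card_eq_of_bijective _ x.cart

theorem coeff_formalSum_single (c : Pi0 (PTree P) → ℚ) (T : Pi0 (PTree P)) :
    MvPowerSeries.coeff (Finsupp.single T 1)
      (formalSum c fun T => Finsupp.single T 1) = c T := by
  classical
  change ∑ᶠ k, MvPowerSeries.coeff (Finsupp.single T 1)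
    (MvPowerSeries.monomial (Finsupp.single k 1) (c k)) = c T
  rw [finsum_eq_single _ T]
  · simp
  · intro k hk
    rw [MvPowerSeries.coeff_monomial, if_neg]
    exact fun h => hk ((Finsupp.single_left_inj one_ne_zero).1 h).symm

theorem coeff_formalSum_of_ne {κ : Type*} (c : κ → ℚ) (m : κ → (Pi0 (PTree P) →₀ ℕ))
    {d : Pi0 (PTree P) →₀ ℕ} (h : ∀ k, d ≠ m k) :
    MvPowerSeries.coeff d (formalSum c m) = 0 := by
  classical
  change ∑ᶠ k, MvPowerSeries.coeff d (MvPowerSeries.monomial (m k) (c k)) = 0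
  rw [finsum_congr fun k => by rw [MvPowerSeries.coeff_monomial, if_neg (h k)]]
  exact finsum_zero

theorem coeff_green_single (T : Pi0 (PTree P)) :
    MvPowerSeries.coeff (Finsupp.single T 1) P.green = (Nat.card (Aut T.out) : ℚ)⁻¹ :=
  coeff_formalSum_single _ T

theorem coeff_green_of_ne {d : Pi0 (PTree P) →₀ ℕ} (h : ∀ T, d ≠ Finsupp.single T 1) :
    MvPowerSeries.coeff d P.green = 0 :=
  coeff_formalSum_of_ne _ _ h

theorem coeff_unitSeries_of_ne {d : Pi0 (PTree P) →₀ ℕ} (h : ∀ T, d ≠ Finsupp.single T 1) :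
    MvPowerSeries.coeff d P.unitSeries = 0 :=
  coeff_formalSum_of_ne _ _ fun _ => h _

/-- As `triv` is fully faithful, non-isomorphic colours give non-isomorphic trees, and a colour has
the same automorphisms as its tree. -/
theorem coeff_unitSeries_triv {T : Pi0 (PTree P)} {i : I}
    (e : (PTree.triv P).obj i ≅ T.out) :
    MvPowerSeries.coeff (Finsupp.single T 1) P.unitSeries = (Nat.card (Aut T.out) : ℚ)⁻¹ := by
  classical
  obtain ⟨e'⟩ := Pi0.nonempty_mk_out_iso i
  have h : (Quotient.mk _ ((PTree.triv P).obj (Quotient.mk _ i : Pi0 I).out) :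
      Pi0 (PTree P)) = T := by
    rw [← T.out_eq]
    exact Pi0.mk_eq_mk_iff.2 ⟨(PTree.triv P).mapIso e' ≪≫ e⟩
  change ∑ᶠ j : Pi0 I, MvPowerSeries.coeff (Finsupp.single T 1) (MvPowerSeries.monomial
    (Finsupp.single (Quotient.mk _ ((PTree.triv P).obj j.out)) 1) _) = _
  rw [finsum_eq_single _ (Quotient.mk _ i)]
  · rw [h, MvPowerSeries.coeff_monomial_same, ← card_aut_congr e,
      ← card_aut_congr ((PTree.triv P).mapIso e')]
    rw [Nat.card_congr ((Functor.FullyFaithful.ofFullyFaithful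
      (PTree.triv P)).autMulEquivOfFullyFaithful _).toEquiv]
  · intro j hj
    rw [MvPowerSeries.coeff_monomial, if_neg]
    intro h'
    have h2 := (Finsupp.single_left_inj one_ne_zero).1 h'
    rw [← h] at h2
    obtain ⟨k⟩ := Pi0.mk_eq_mk_iff.1 h2
    apply hj
    rw [← j.out_eq]
    exact Pi0.mk_eq_mk_iff.2 ⟨(PTree.triv P).preimageIso k.symm ≪≫ e'⟩

theorem coeff_unitSeries_graft {T : Pi0 (PTree P)} {x : P.EvalT} (e : P.graft.obj x ≅ T.out) :
    MvPowerSeries.coeff (Finsupp.single T 1) P.unitSeries = 0 := by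
  refine coeff_formalSum_of_ne _ _ fun i h => ?_
  have h' := (Finsupp.single_left_inj one_ne_zero).1 h
  rw [← T.out_eq] at h'
  obtain ⟨k⟩ := Pi0.mk_eq_mk_iff.1 h'
  exact (PTree.isEmpty_graft_hom_triv _ _).false (e ≪≫ k).hom

/-- A tree ungrafts in essentially one way, so its row in the matrix has one relevant column; the
sum over forests reduces to it. -/
theorem coeff_spanOp {M : Type*} [Category M] {L : M ⥤ PForest P} {R : M ⥤ PTree P}
    {T : Pi0 (PTree P)} (F : PForest P) (k : ℚ) [DecidableEq (Pi0 (PForest P))]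
    (h : ∀ F', spanCoeff L R F' T = if F' = Quotient.mk _ F then k else 0) (f : P.Completion) :
    MvPowerSeries.coeff (Finsupp.single T 1) (spanOp L R f) =
      MvPowerSeries.coeff F.monomial f * k := by
  obtain ⟨e⟩ := Pi0.nonempty_mk_out_iso F
  rw [spanOp, coeff_formalSum_single, finsum_eq_single _ (Quotient.mk _ F), h, if_pos rfl,
    PForest.monomial_eq_of_iso e]
  intro F' hF
  rw [h, if_neg hF, mul_zero]

theorem coeff_spanOp_of_ne {M : Type*} [Category M] {L : M ⥤ PForest P} {R : M ⥤ PTree P}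
    {d : Pi0 (PTree P) →₀ ℕ} (h : ∀ T, d ≠ Finsupp.single T 1) (f : P.Completion) :
    MvPowerSeries.coeff d (spanOp L R f) = 0 :=
  coeff_formalSum_of_ne _ _ h

theorem spanCoeff_of_isEmpty {M : Type*} [Category M] {L : M ⥤ PForest P} {R : M ⥤ PTree P}
    {T : Pi0 (PTree P)} (h : ∀ m, IsEmpty (R.obj m ⟶ T.out)) (F : Pi0 (PForest P)) :
    spanCoeff L R F T = 0 := by
  have : IsEmpty (CostructuredArrow (L.prod' R) (F.out, T.out)) :=
    ⟨fun c => (h c.left).false c.hom.2⟩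
  rw [spanCoeff, hcard_of_isEmpty, zero_div]

theorem isEmpty_graft_hom {T : PTree P} {i : I} (e : (PTree.triv P).obj i ≅ T) (x : P.EvalT) :
    IsEmpty (P.graft.obj x ⟶ T) :=
  ⟨fun f => (PTree.isEmpty_graft_hom_triv i x).false (f ≫ e.inv)⟩

theorem spanCoeff_graft [DecidableEq (Pi0 (PForest P))] {T : Pi0 (PTree P)} {x : P.EvalT}
    (e : P.graft.obj x ≅ T.out) (F : Pi0 (PForest P)) :
    spanCoeff P.toForest P.graft F T = if F = Quotient.mk _ (P.toForest.obj x) then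
      (Nat.card (Aut (P.toForest.obj x)) : ℚ) / Nat.card (Aut T.out) else 0 := by
  rw [spanCoeff, hcard_fiber_prod PTree.isIso _ _ _ e.hom, card_hom_out PForest.isIso]
  split_ifs <;> simp

/-- Compared with the global operator, a point of the fibre carries in addition an arrow from the
root operation to `b`, whence the last factor. -/
theorem spanCoeff_graftFib [DecidableEq (Pi0 (PForest P))] {T : Pi0 (PTree P)} {x : P.EvalT}
    (e : P.graft.obj x ≅ T.out) (b : B) (F : Pi0 (PForest P)) :
    spanCoeff (P.toForestFib b) (P.graftFib b) F T =
      if F = Quotient.mk _ (P.toForest.obj x) then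
        (Nat.card (Aut (P.toForest.obj x)) : ℚ) / Nat.card (Aut T.out) *
          Nat.card (x.op ⟶ b) else 0 := by
  have h := hcard_fiber_prod_fiber PTree.isIso P.toForest P.graft
    (Eval.toOp (PTree.rootColour P)) b F.out e.hom
  rw [spanCoeff, toForestFib, graftFib, h, card_hom_out PForest.isIso]
  split_ifs
  · rw [mul_div_right_comm]
    rfl
  · simp

theorem coeff_bPlus_triv {T : Pi0 (PTree P)} {i : I} (e : (PTree.triv P).obj i ≅ T.out)
    (f : P.Completion) : MvPowerSeries.coeff (Finsupp.single T 1) (P.bPlus f) = 0 := by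
  rw [bPlus, spanOp, coeff_formalSum_single]
  simp [spanCoeff_of_isEmpty (isEmpty_graft_hom e)]

theorem coeff_bPlusAt_triv {T : Pi0 (PTree P)} {i : I} (e : (PTree.triv P).obj i ≅ T.out) (b : B)
    (f : P.Completion) : MvPowerSeries.coeff (Finsupp.single T 1) (P.bPlusAt b f) = 0 := by
  rw [bPlusAt, spanOp, coeff_formalSum_single]
  simp [spanCoeff_of_isEmpty (R := P.graftFib b) fun m => isEmpty_graft_hom e m.left]

theorem coeff_bPlus_graft {T : Pi0 (PTree P)} {x : P.EvalT} (e : P.graft.obj x ≅ T.out)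
    (f : P.Completion) : MvPowerSeries.coeff (Finsupp.single T 1) (P.bPlus f) =
      MvPowerSeries.coeff (P.toForest.obj x).monomial f *
        ((Nat.card (Aut (P.toForest.obj x)) : ℚ) / Nat.card (Aut T.out)) := by
  classical
  exact coeff_spanOp _ _ (spanCoeff_graft e) f

theorem coeff_bPlusAt_graft {T : Pi0 (PTree P)} {x : P.EvalT} (e : P.graft.obj x ≅ T.out) (b : B)
    (f : P.Completion) : MvPowerSeries.coeff (Finsupp.single T 1) (P.bPlusAt b f) =
      MvPowerSeries.coeff (P.toForest.obj x).monomial f *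
        ((Nat.card (Aut (P.toForest.obj x)) : ℚ) / Nat.card (Aut T.out) *
          Nat.card (x.op ⟶ b)) := by
  classical
  exact coeff_spanOp _ _ (spanCoeff_graftFib e b) f

theorem finite_spanCoeff (T : Pi0 (PTree P)) :
    {F | spanCoeff P.toForest P.graft F T ≠ 0}.Finite := by
  classical
  rcases T.out.exists_iso with ⟨i, ⟨e⟩⟩ | ⟨x, ⟨e⟩⟩
  · simp [spanCoeff_of_isEmpty (isEmpty_graft_hom e)]
  · refine (Set.finite_singleton (Quotient.mk _ (P.toForest.obj x))).subset fun F hF => ?_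
    by_contra h
    exact hF ((spanCoeff_graft e F).trans (if_neg h))

theorem finite_spanCoeffFib (b : B) (T : Pi0 (PTree P)) :
    {F | spanCoeff (P.toForestFib b) (P.graftFib b) F T ≠ 0}.Finite := by
  classical
  rcases T.out.exists_iso with ⟨i, ⟨e⟩⟩ | ⟨x, ⟨e⟩⟩
  · simp [spanCoeff_of_isEmpty (R := P.graftFib b) fun m => isEmpty_graft_hom e m.left]
  · refine (Set.finite_singleton (Quotient.mk _ (P.toForest.obj x))).subset fun F hF => ?_
    by_contra h
    exact hF ((spanCoeff_graftFib e b F).trans (if_neg h))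

theorem coeff_bPlus_eq_finsum (hB : ∀ b : B, Finite (Aut b)) (f : P.Completion)
    (d : Pi0 (PTree P) →₀ ℕ) :
    MvPowerSeries.coeff d (P.bPlus f) =
      ∑ᶠ b : Pi0 B, (Nat.card (Aut b.out) : ℚ)⁻¹ *
        MvPowerSeries.coeff d (P.bPlusAt b.out f) := by
  by_cases hd : ∃ T, d = Finsupp.single T 1
  · obtain ⟨T, rfl⟩ := hd
    rcases T.out.exists_iso with ⟨i, ⟨e⟩⟩ | ⟨x, ⟨e⟩⟩
    · simp [coeff_bPlus_triv e, coeff_bPlusAt_triv e]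
    · simp only [coeff_bPlus_graft e, coeff_bPlusAt_graft e, ← mul_assoc (MvPowerSeries.coeff _ f)]
      exact (finsum_inv_card_aut_mul_card_hom (fun _ => inferInstance) hB x.op fun _ => _).symm
  · push Not at hd
    simp [bPlus, bPlusAt, coeff_spanOp_of_ne hd]

/-- Rules out the default value 0 of `Nat.card`, so that `|Aut F|` can be cancelled. -/
theorem card_aut_forest_pos (hT : ∀ S T : PTree P, Finite (S ⟶ T)) (F : PForest P) :
    0 < Nat.card (Aut F) := by
  have := F.fin
  rw [card_aut_eq PForest.isIso]
  have : Finite (F ⟶ F) := by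
    refine Finite.of_injective (β := Σ σ : F.ι → F.ι, ∀ i, F.tree i ⟶ F.tree (σ i))
      (fun f => ⟨PForest.Hom.perm f, PForest.Hom.iso f⟩) fun f g h => ?_
    obtain ⟨h1, h2⟩ := Sigma.mk.inj h
    exact PForest.Hom.ext h1 h2
  have : Nonempty (F ⟶ F) := ⟨𝟙 F⟩
  exact Nat.card_pos

theorem coeff_expGreen (hT : ∀ S T : PTree P, Finite (S ⟶ T)) (F : PForest P) :
    MvPowerSeries.coeff F.monomial P.expGreen = (Nat.card (Aut F) : ℚ)⁻¹ := by
  rw [F.card_aut hT]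
  exact coeff_exp_linear coeff_green_single (fun _ => coeff_green_of_ne) _

theorem coeff_green_pow (hT : ∀ S T : PTree P, Finite (S ⟶ T)) (F : PForest P) :
    MvPowerSeries.coeff F.monomial (P.green ^ Nat.card F.ι) =
      (Nat.card F.ι).factorial * (Nat.card (Aut F) : ℚ)⁻¹ := by
  rw [F.card_aut hT, coeff_linear_pow coeff_green_single (fun _ => coeff_green_of_ne),
    if_pos F.degree_monomial]

theorem green_eq (hT : ∀ S T : PTree P, Finite (S ⟶ T)) :
    P.green = P.unitSeries + P.bPlus P.expGreen := by
  ext d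
  rw [map_add]
  by_cases hd : ∃ T, d = Finsupp.single T 1
  · obtain ⟨T, rfl⟩ := hd
    rw [coeff_green_single]
    rcases T.out.exists_iso with ⟨i, ⟨e⟩⟩ | ⟨x, ⟨e⟩⟩
    · rw [coeff_bPlus_triv e, coeff_unitSeries_triv e, add_zero]
    · have h : (Nat.card (Aut (P.toForest.obj x)) : ℚ) ≠ 0 :=
        Nat.cast_ne_zero.2 (card_aut_forest_pos hT _).ne'
      -- The coefficient `1 / |Aut F|` of `exp G` cancels the numerator of the entry `|Aut F| / |Aut
      -- T|`.
      rw [coeff_bPlus_graft e, coeff_unitSeries_graft e, coeff_expGreen hT, zero_add,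
        ← mul_div_assoc, inv_mul_cancel₀ h, one_div]
  · push Not at hd
    rw [bPlus, coeff_spanOp_of_ne hd, coeff_green_of_ne hd, coeff_unitSeries_of_ne hd, add_zero]

theorem coeff_green_eq (hT : ∀ S T : PTree P, Finite (S ⟶ T)) (hB : ∀ b : B, Finite (Aut b))
    (d : Pi0 (PTree P) →₀ ℕ) :
    MvPowerSeries.coeff d P.green = MvPowerSeries.coeff d P.unitSeries +
      ∑ᶠ b : Pi0 B, (Nat.card (Aut b.out) : ℚ)⁻¹ * ((P.arity b.out).factorial : ℚ)⁻¹ *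
        MvPowerSeries.coeff d (P.bPlusAt b.out (P.green ^ P.arity b.out)) := by
  by_cases hd : ∃ T, d = Finsupp.single T 1
  · obtain ⟨T, rfl⟩ := hd
    rw [coeff_green_single]
    rcases T.out.exists_iso with ⟨i, ⟨e⟩⟩ | ⟨x, ⟨e⟩⟩
    · simp [coeff_bPlusAt_triv e, coeff_unitSeries_triv e]
    · have h : (Nat.card (Aut (P.toForest.obj x)) : ℚ) ≠ 0 :=
        Nat.cast_ne_zero.2 (card_aut_forest_pos hT _).ne'
      obtain ⟨e'⟩ := Pi0.nonempty_mk_out_iso x.op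
      -- The arity at the representative of the class of `x.op` is the number of trees of the
      -- forest, so the factorial from `coeff_green_pow` cancels `n_b!`.
      have hn : P.arity (Quotient.mk _ x.op : Pi0 B).out = Nat.card (P.toForest.obj x).ι :=
        (arity_congr e').trans x.card_ι.symm
      have hfac : ((Nat.card (P.toForest.obj x).ι).factorial : ℚ) ≠ 0 := by positivity
      simp only [coeff_bPlusAt_graft e, mul_assoc (_⁻¹ : ℚ) (_⁻¹), coeff_unitSeries_graft e,
        zero_add]
      simp only [← mul_assoc (MvPowerSeries.coeff _ _), ← mul_assoc (Nat.cast (Nat.factorial _))⁻¹]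
      rw [finsum_inv_card_aut_mul_card_hom (fun _ => inferInstance) hB x.op fun b =>
        ((P.arity b.out).factorial : ℚ)⁻¹ * MvPowerSeries.coeff (P.toForest.obj x).monomial
          (P.green ^ P.arity b.out) *
            ((Nat.card (Aut (P.toForest.obj x)) : ℚ) / Nat.card (Aut T.out)), hn, coeff_green_pow hT]
      field_simp
  · push Not at hd
    simp [bPlusAt, coeff_spanOp_of_ne hd, coeff_green_of_ne hd, coeff_unitSeries_of_ne hd]

end PolyEndo

end

theorem mainTheorem3 {I : Type u₁} {E : Type u₂} {B : Type u₃}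
    [Groupoid.{v₁} I] [Groupoid.{v₂} E] [Groupoid.{v₃} B]
    (P : PolyEndo I E B) (hP : P.Finitary)
    (hI : ∀ i : I, Finite (Aut i)) (hB : ∀ b : B, Finite (Aut b)) :
    -- the structure equivalence `1 + P(𝐓) ≃ 𝐓`
    P.structureMap.IsEquivalence ∧
    -- the matrices of the `B₊`-operators are row-finite, so the operators extend to the completion
    (∀ T, {F | PolyEndo.spanCoeff P.toForest P.graft F T ≠ 0}.Finite) ∧
    (∀ b T, {F | PolyEndo.spanCoeff (P.toForestFib b) (P.graftFib b) F T ≠ 0}.Finite) ∧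
    -- the global operator is the homotopy sum of the individual ones
    (∀ f d, MvPowerSeries.coeff d (P.bPlus f) =
      ∑ᶠ b : Pi0 B, (Nat.card (Aut b.out) : ℚ)⁻¹ * MvPowerSeries.coeff d (P.bPlusAt b.out f)) ∧
    -- the Dyson-Schwinger equation for the global operator
    P.green = P.unitSeries + P.bPlus P.expGreen ∧
    -- the same equation, written out in terms of powers of `G` and individual operators
    (∀ d, MvPowerSeries.coeff d P.green = MvPowerSeries.coeff d P.unitSeries +
      ∑ᶠ b : Pi0 B, (Nat.card (Aut b.out) : ℚ)⁻¹ * ((P.arity b.out).factorial : ℚ)⁻¹ *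
        MvPowerSeries.coeff d (P.bPlusAt b.out (P.green ^ P.arity b.out))) := by

  have hT := PTree.finite_hom hP hI hB
  exact ⟨P.structureMap_isEquivalence, PolyEndo.finite_spanCoeff, PolyEndo.finite_spanCoeffFib,
    PolyEndo.coeff_bPlus_eq_finsum hB, PolyEndo.green_eq hT, PolyEndo.coeff_green_eq hT hB⟩
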